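/- Let $\mathfrak{A}[\mathbb{R}^2]$ denote the Weyl algebra over $\mathbb{R}^2$, i.e. the $C^*$-algebra generated by unitaries $W(\mathbf a)$, $\mathbf a\in\mathbb{R}^2$, satisfying the Weyl relations $$W(\mathbf a)W(\mathbf b)=e^{i\sigma(\mathbf a,\mathbf b)}\,W(\mathbf a+\mathbf b),\qquad \sigma\big((a,b),(a',b')\big)=\tfrac12(ab'-ba'),$$ and let $\mathfrak{A}=\mathfrak{A}[\mathbb{R}^2]\otimes\mathfrak{A}[\mathbb{R}^2]$ be the spatial tensor product. For mutually commuting $*$-subalgebras $\mathfrak{A}_1,\mathfrak{A}_2$ of $\mathfrak{A}$, a Bell operator for $\mathfrak{A}_1,\mathfrak{A}_2$ is an element of the form $$R=\tfrac12\big[A_1(B_1+B_2)+A_2(B_1-B_2)\big],\qquad A_i=A_i^*\in\mathfrak{A}_1,\ B_i=B_i^*\in\mathfrak{A}_2,\ \|A_i\|\le1,\ \|B_i\|\le1\quad(i=1,2).$$ Let $\lambda,\mu\in\mathbb{R}$. There is exactly one state (normalized positive linear functional) $\omega$ of $\mathfrak{A}$, the EPR state, such that $$\omega\big(W(a,0)\otimes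 W(-a,0)\big)=e^{ia\lambda},\qquad \omega\big(W(0,b)\otimes W(0,b)\big)=e^{ib\mu}\qquad\text{for all }a,b\in\mathbb{R},$$ and this state is maximally Bell correlated across the pair $\mathfrak{A}[\mathbb{R}^2]\otimes I,\ I\otimes\mathfrak{A}[\mathbb{R}^2]$: the supremum of the real numbers $\omega(R)$ over all Bell operators $R$ for this pair equals $\sqrt2$. -/

import Mathlib

/-! ### States and Bell correlations in C*-algebras -/

section CStar

variable {A : Type*} [CStarAlgebra A]

open scoped ComplexOrder in
/-- A state of a unital C*-algebra: a linear functional that is normalized and positive, the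
positive elements of a C*-algebra being those of the form `a* a`. -/
structure IsState (ω : A →ₗ[ℂ] ℂ) : Prop where
  map_one : ω 1 = 1
  nonneg : ∀ a : A, 0 ≤ ω (star a * a)

/-- The Bell operators for a pair of (mutually commuting) *-subalgebras `A₁`, `A₂` of `A`. -/
def bellOperators (A₁ A₂ : StarSubalgebra ℂ A) : Set A :=
  {R | ∃ a₁ ∈ A₁, ∃ a₂ ∈ A₁, ∃ b₁ ∈ A₂, ∃ b₂ ∈ A₂,
    (IsSelfAdjoint a₁ ∧ ‖a₁‖ ≤ 1) ∧ (IsSelfAdjoint a₂ ∧ ‖a₂‖ ≤ 1) ∧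
    (IsSelfAdjoint b₁ ∧ ‖b₁‖ ≤ 1) ∧ (IsSelfAdjoint b₂ ∧ ‖b₂‖ ≤ 1) ∧
    R = (1 / 2 : ℂ) • (a₁ * (b₁ + b₂) + a₂ * (b₁ - b₂))}

/-- `ω` is maximally Bell correlated across `A₁, A₂`: the supremum of the (real) numbers `ω R`,
`R` a Bell operator, is `√2`. -/
def IsMaximallyBellCorrelated (ω : A →ₗ[ℂ] ℂ) (A₁ A₂ : StarSubalgebra ℂ A) : Prop :=
  IsLUB {x : ℝ | ∃ R ∈ bellOperators A₁ A₂, ω R = (x : ℂ)} (Real.sqrt 2)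

end CStar

/-! ### The spatial tensor product of concrete C*-algebras -/

noncomputable section SpatialTensor

set_option linter.unusedSectionVars false

open scoped TensorProduct

variable (H K : Type*) [NormedAddCommGroup H] [InnerProductSpace ℂ H] [CompleteSpace H]
  [NormedAddCommGroup K] [InnerProductSpace ℂ K] [CompleteSpace K]

/-- The Hilbert space tensor product: the completion of the algebraic tensor product with
respect to the inner product `⟪x ⊗ y, x' ⊗ y'⟫ = ⟪x, x'⟫ ⟪y, y'⟫`. -/
def HilbertTensor : Type _ := UniformSpace.Completion (H ⊗[ℂ] K)

instance : NormedAddCommGroup (HilbertTensor H K) :=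
  inferInstanceAs (NormedAddCommGroup (UniformSpace.Completion (H ⊗[ℂ] K)))

instance : InnerProductSpace ℂ (HilbertTensor H K) :=
  inferInstanceAs (InnerProductSpace ℂ (UniformSpace.Completion (H ⊗[ℂ] K)))

instance : CompleteSpace (HilbertTensor H K) :=
  inferInstanceAs (CompleteSpace (UniformSpace.Completion (H ⊗[ℂ] K)))

variable {H K}

/-- The inclusion of the algebraic tensor product, a linear isometry with dense range. -/
def HilbertTensor.incl : H ⊗[ℂ] K →ₗᵢ[ℂ] HilbertTensor H K :=
  (UniformSpace.Completion.toComplₗᵢ : H ⊗[ℂ] K →ₗᵢ[ℂ] UniformSpace.Completion (H ⊗[ℂ] K))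

theorem HilbertTensor.denseRange_incl :
    DenseRange (HilbertTensor.incl : H ⊗[ℂ] K → HilbertTensor H K) :=
  UniformSpace.Completion.denseRange_coe

/-- The bounded operator `a ⊗ b` on the Hilbert space tensor product. -/
def tensorOp (a : H →L[ℂ] H) (b : K →L[ℂ] K) : HilbertTensor H K →L[ℂ] HilbertTensor H K :=
  ((TensorProduct.mapL a b).completion :
    UniformSpace.Completion (H ⊗[ℂ] K) →L[ℂ] UniformSpace.Completion (H ⊗[ℂ] K))

theorem tensorOp_incl (a : H →L[ℂ] H) (b : K →L[ℂ] K) (x : H ⊗[ℂ] K) :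
    tensorOp a b (HilbertTensor.incl x) = HilbertTensor.incl (TensorProduct.mapL a b x) :=
  ContinuousLinearMap.completion_apply_coe (TensorProduct.mapL a b) x

theorem HilbertTensor.clm_ext {f g : HilbertTensor H K →L[ℂ] HilbertTensor H K}
    (h : ∀ x : H ⊗[ℂ] K, f (HilbertTensor.incl x) = g (HilbertTensor.incl x)) : f = g :=
  DFunLike.coe_injective
    (HilbertTensor.denseRange_incl.equalizer f.continuous g.continuous (funext h))

theorem tensorOp_one : tensorOp (1 : H →L[ℂ] H) (1 : K →L[ℂ] K) = 1 := by
  refine HilbertTensor.clm_ext fun x => ?_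
  rw [tensorOp_incl]
  exact congrArg _ (congrArg (fun f : H ⊗[ℂ] K →L[ℂ] H ⊗[ℂ] K => f x) TensorProduct.mapL_id_id)

theorem tensorOp_mul (a a' : H →L[ℂ] H) (b b' : K →L[ℂ] K) :
    tensorOp (a * a') (b * b') = tensorOp a b * tensorOp a' b' := by
  refine HilbertTensor.clm_ext fun x => ?_
  simp only [mul_apply_eq_comp, tensorOp_incl, TensorProduct.mapL_mul]

theorem tensorOp_add_left (a a' : H →L[ℂ] H) (b : K →L[ℂ] K) :
    tensorOp (a + a') b = tensorOp a b + tensorOp a' b := by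
  refine HilbertTensor.clm_ext fun x => ?_
  simp only [add_apply, tensorOp_incl, TensorProduct.mapL_add_left, map_add]

theorem tensorOp_add_right (a : H →L[ℂ] H) (b b' : K →L[ℂ] K) :
    tensorOp a (b + b') = tensorOp a b + tensorOp a b' := by
  refine HilbertTensor.clm_ext fun x => ?_
  simp only [add_apply, tensorOp_incl, TensorProduct.mapL_add_right, map_add]

theorem tensorOp_smul_left (c : ℂ) (a : H →L[ℂ] H) (b : K →L[ℂ] K) :
    tensorOp (c • a) b = c • tensorOp a b := by
  refine HilbertTensor.clm_ext fun x => ?_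
  simp only [smul_apply, tensorOp_incl, TensorProduct.mapL_smul_left, map_smul]

theorem tensorOp_smul_right (c : ℂ) (a : H →L[ℂ] H) (b : K →L[ℂ] K) :
    tensorOp a (c • b) = c • tensorOp a b := by
  refine HilbertTensor.clm_ext fun x => ?_
  simp only [smul_apply, tensorOp_incl, TensorProduct.mapL_smul_right, map_smul]

theorem inner_mapL_star (a : H →L[ℂ] H) (b : K →L[ℂ] K) (x y : H ⊗[ℂ] K) :
    inner ℂ (TensorProduct.mapL (star a) (star b) x) y = inner ℂ x (TensorProduct.mapL a b y) := by
  induction x with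
  | zero => simp
  | add x₁ x₂ h₁ h₂ => rw [map_add, inner_add_left, inner_add_left, h₁, h₂]
  | tmul u v =>
    induction y with
    | zero => simp
    | add y₁ y₂ h₁ h₂ => rw [map_add, inner_add_right, inner_add_right, h₁, h₂]
    | tmul u' v' =>
      simp [ContinuousLinearMap.star_eq_adjoint, ContinuousLinearMap.adjoint_inner_left]

theorem tensorOp_star (a : H →L[ℂ] H) (b : K →L[ℂ] K) :
    tensorOp (star a) (star b) = star (tensorOp a b) := by
  rw [ContinuousLinearMap.star_eq_adjoint (tensorOp a b), ContinuousLinearMap.eq_adjoint_iff]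
  intro z w
  refine HilbertTensor.denseRange_incl.induction_on₂
    (p := fun z w => inner ℂ (tensorOp (star a) (star b) z) w = inner ℂ z (tensorOp a b w))
    (isClosed_eq (by fun_prop) (by fun_prop)) (fun x y => ?_) z w
  rw [tensorOp_incl, tensorOp_incl, LinearIsometry.inner_map_map,
    LinearIsometry.inner_map_map, inner_mapL_star]

/-- The spatial tensor product of two concrete C*-algebras `S ⊆ B(H)` and `T ⊆ B(K)`: the
C*-subalgebra of `B(H ⊗ K)` generated by the operators `a ⊗ b`. -/
def spatialTensor (S : StarSubalgebra ℂ (H →L[ℂ] H)) (T : StarSubalgebra ℂ (K →L[ℂ] K)) :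
    StarSubalgebra ℂ (HilbertTensor H K →L[ℂ] HilbertTensor H K) :=
  (StarAlgebra.adjoin ℂ {x | ∃ a ∈ S, ∃ b ∈ T, x = tensorOp a b}).topologicalClosure

variable (S : StarSubalgebra ℂ (H →L[ℂ] H)) (T : StarSubalgebra ℂ (K →L[ℂ] K))

instance spatialTensorCStarAlgebra : CStarAlgebra (spatialTensor S T) :=
  StarSubalgebra.cstarAlgebra _ (h_closed := StarSubalgebra.isClosed_topologicalClosure _)

variable {S T} in
theorem tensorOp_mem (a : S) (b : T) :
    tensorOp (a : H →L[ℂ] H) (b : K →L[ℂ] K) ∈ spatialTensor S T :=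
  StarSubalgebra.le_topologicalClosure _
    (StarAlgebra.subset_adjoin ℂ _ ⟨a, a.2, b, b.2, rfl⟩)

variable {S T} in
/-- The elementary tensor `a ⊗ b` as an element of the spatial tensor product. -/
def elemTensor (a : S) (b : T) : spatialTensor S T := ⟨tensorOp a b, tensorOp_mem a b⟩

/-- The embedding `a ↦ a ⊗ I`. -/
def leftEmbedding : S →⋆ₐ[ℂ] spatialTensor S T where
  toFun a := elemTensor a 1
  map_one' := Subtype.ext tensorOp_one
  map_mul' a a' := Subtype.ext <| by
    simpa [elemTensor] using tensorOp_mul (a : H →L[ℂ] H) a' (1 : K →L[ℂ] K) 1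
  map_zero' := Subtype.ext <| by
    simpa [elemTensor] using tensorOp_smul_left (0 : ℂ) (0 : H →L[ℂ] H) (1 : K →L[ℂ] K)
  map_add' a a' := Subtype.ext <| tensorOp_add_left (a : H →L[ℂ] H) a' (1 : K →L[ℂ] K)
  commutes' c := Subtype.ext <| by
    have h := tensorOp_smul_left c (1 : H →L[ℂ] H) (1 : K →L[ℂ] K)
    rw [tensorOp_one] at h
    simpa [elemTensor, Algebra.algebraMap_eq_smul_one] using h
  map_star' a := Subtype.ext <| by
    simpa [elemTensor] using tensorOp_star (a : H →L[ℂ] H) (1 : K →L[ℂ] K)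

/-- The embedding `b ↦ I ⊗ b`. -/
def rightEmbedding : T →⋆ₐ[ℂ] spatialTensor S T where
  toFun b := elemTensor 1 b
  map_one' := Subtype.ext tensorOp_one
  map_mul' b b' := Subtype.ext <| by
    simpa [elemTensor] using tensorOp_mul (1 : H →L[ℂ] H) 1 (b : K →L[ℂ] K) b'
  map_zero' := Subtype.ext <| by
    simpa [elemTensor] using tensorOp_smul_right (0 : ℂ) (1 : H →L[ℂ] H) (0 : K →L[ℂ] K)
  map_add' b b' := Subtype.ext <| tensorOp_add_right (1 : H →L[ℂ] H) (b : K →L[ℂ] K) b'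
  commutes' c := Subtype.ext <| by
    have h := tensorOp_smul_right c (1 : H →L[ℂ] H) (1 : K →L[ℂ] K)
    rw [tensorOp_one] at h
    simpa [elemTensor, Algebra.algebraMap_eq_smul_one] using h
  map_star' b := Subtype.ext <| by
    simpa [elemTensor] using tensorOp_star (1 : H →L[ℂ] H) (b : K →L[ℂ] K)

/-- The subalgebra `S ⊗ I` of the spatial tensor product. -/
def leftFactor : StarSubalgebra ℂ (spatialTensor S T) := (leftEmbedding S T).range

/-- The subalgebra `I ⊗ T` of the spatial tensor product. -/
def rightFactor : StarSubalgebra ℂ (spatialTensor S T) := (rightEmbedding S T).range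

end SpatialTensor

/-! ### The Weyl algebra over `ℝ²` -/

noncomputable section Weyl

/-- The symplectic form `σ((a, b), (a', b')) = (a b' - b a') / 2`. -/
def weylForm (u v : ℝ × ℝ) : ℝ := (u.1 * v.2 - u.2 * v.1) / 2

/-- The Hilbert space `ℓ²(ℝ²)`, with `ℝ²` as a discrete set. -/
abbrev WeylSpace : Type := lp (fun _ : ℝ × ℝ => ℂ) 2

theorem norm_weylPhase (t : ℝ) : ‖Complex.exp (Complex.I * t)‖ = 1 := by
  rw [mul_comm]; exact Complex.norm_exp_ofReal_mul_I t

theorem weyl_memℓp (u : ℝ × ℝ) (f : WeylSpace) :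
    Memℓp (fun x : ℝ × ℝ => Complex.exp (Complex.I * weylForm u x) * f (x - u)) 2 := by
  have h := (memℓp_gen_iff (by norm_num)).1 (lp.memℓp f)
  refine (memℓp_gen_iff (by norm_num)).2 ?_
  simp only [norm_mul, norm_weylPhase, one_mul]
  exact (Equiv.subRight u).summable_iff.2 h

/-- The Weyl operator `W(u)` on `ℓ²(ℝ²)`, `(W(u) f)(x) = exp(i σ(u, x)) f(x - u)`. -/
def weylIsometry (u : ℝ × ℝ) : WeylSpace →ₗᵢ[ℂ] WeylSpace where
  toFun f := ⟨fun x => Complex.exp (Complex.I * weylForm u x) * f (x - u), weyl_memℓp u f⟩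
  map_add' f g := by
    ext x
    exact mul_add _ _ _
  map_smul' c f := by
    ext x
    simp only [lp.coeFn_smul, Pi.smul_apply, smul_eq_mul, RingHom.id_apply]
    ring
  norm_map' f := by
    have h2 : (0 : ℝ) < (2 : ENNReal).toReal := by norm_num
    rw [lp.norm_eq_tsum_rpow h2, lp.norm_eq_tsum_rpow h2]
    congr 1
    simp only [LinearMap.coe_mk, AddHom.coe_mk, norm_mul, norm_weylPhase, one_mul]
    exact (Equiv.subRight u).tsum_eq (fun x => ‖f x‖ ^ (2 : ENNReal).toReal)

/-- The Weyl operator `W(u)` as a bounded operator. -/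
def weylOp (u : ℝ × ℝ) : WeylSpace →L[ℂ] WeylSpace := (weylIsometry u).toContinuousLinearMap

theorem weylOp_apply (u : ℝ × ℝ) (f : WeylSpace) (x : ℝ × ℝ) :
    weylOp u f x = Complex.exp (Complex.I * weylForm u x) * f (x - u) := rfl

/-- The Weyl relations. -/
theorem weylOp_mul (u v : ℝ × ℝ) :
    weylOp u * weylOp v = Complex.exp (Complex.I * weylForm u v) • weylOp (u + v) := by
  ext f x
  have e : Complex.exp (Complex.I * weylForm u x) * Complex.exp (Complex.I * weylForm v (x - u))
      = Complex.exp (Complex.I * weylForm u v) *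
        Complex.exp (Complex.I * weylForm (u + v) x) := by
    rw [← Complex.exp_add, ← Complex.exp_add]
    congr 1
    simp only [weylForm, Prod.fst_sub, Prod.snd_sub, Prod.fst_add, Prod.snd_add]
    push_cast
    ring
  simp only [mul_apply_eq_comp, smul_apply, lp.coeFn_smul,
    Pi.smul_apply, smul_eq_mul, weylOp_apply]
  rw [← mul_assoc, e, mul_assoc, sub_sub]

theorem weylOp_zero : weylOp 0 = 1 := by
  ext f x
  simp [weylOp_apply, weylForm]

theorem weylOp_mul_neg (u : ℝ × ℝ) : weylOp u * weylOp (-u) = 1 := by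
  rw [weylOp_mul, add_neg_cancel, weylOp_zero]
  have : weylForm u (-u) = 0 := by simp only [weylForm, Prod.fst_neg, Prod.snd_neg]; ring
  simp [this]

/-- The Weyl operators are unitary. -/
theorem weylOp_mem_unitary (u : ℝ × ℝ) : weylOp u ∈ unitary (WeylSpace →L[ℂ] WeylSpace) := by
  have h : star (weylOp u) * weylOp u = 1 :=
    (ContinuousLinearMap.norm_map_iff_adjoint_comp_self _).1 (weylIsometry u).norm_map
  have h' : star (weylOp u) = weylOp (-u) := by
    calc star (weylOp u) = star (weylOp u) * (weylOp u * weylOp (-u)) := by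
          rw [weylOp_mul_neg, mul_one]
      _ = weylOp (-u) := by rw [← mul_assoc, h, one_mul]
  exact Unitary.mem_iff.2 ⟨h, by rw [h', weylOp_mul_neg]⟩

/-- The Weyl algebra over `ℝ²`: the C*-algebra generated by the unitaries `W(u)`. -/
def weylAlgebra : StarSubalgebra ℂ (WeylSpace →L[ℂ] WeylSpace) :=
  (StarAlgebra.adjoin ℂ (Set.range weylOp)).topologicalClosure

/-- The generator `W(a, b)` of the Weyl algebra. -/
def weyl (a b : ℝ) : weylAlgebra :=
  ⟨weylOp (a, b), StarSubalgebra.le_topologicalClosure _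
    (StarAlgebra.subset_adjoin ℂ _ ⟨(a, b), rfl⟩)⟩

/-- The spatial tensor product of two copies of the Weyl algebra over `ℝ²`. -/
abbrev TwoParticleAlgebra : Type := spatialTensor weylAlgebra weylAlgebra

/-- `ω` is an EPR state with relative position `l` and total momentum `m`: a state with
`ω(W(a, 0) ⊗ W(-a, 0)) = exp(i a l)` and `ω(W(0, b) ⊗ W(0, b)) = exp(i b m)` for all `a`, `b`. -/
structure IsEPRState (l m : ℝ) (ω : TwoParticleAlgebra →ₗ[ℂ] ℂ) : Prop where
  isState : IsState ω
  position : ∀ a : ℝ, ω (elemTensor (weyl a 0) (weyl (-a) 0)) = Complex.exp (Complex.I * (a * l))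
  momentum : ∀ b : ℝ, ω (elemTensor (weyl 0 b) (weyl 0 b)) = Complex.exp (Complex.I * (b * m))

end Weyl

/-! Write `reflect (a, b) = (-a, b)`. This map reverses the sign of the symplectic form, so the
phases in the Weyl relations cancel and `p ↦ W(p) ⊗ W(reflect p)` is a unitary representation of the
commutative group `ℝ²`. An EPR state restricts to a character on it.

Existence: the character is bounded by the operator norm. The orbit of `δ₀ ⊗ δ₀` is orthonormal, so
the norm dominates the `ℓ²` norm of the coefficients, and the polynomial growth of `ℝ²` removes the
remaining factor (`MonoidAlgebra.norm_character_le`). Hahn–Banach then gives a contractive unital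
functional, which is a state.

Uniqueness: a unitary on which a state has modulus one acts as a scalar under the state. This fixes
the state on the whole representation and makes it vanish on every other `W(p) ⊗ W(q)`, because some
member of the representation anticommutes with it.

Bell correlation: Tsirelson's bound is a sum-of-squares identity. For the converse, `W(1, 0)` and
`W(0, π)` anticommute, are perfectly correlated with their reflected partners, and are uniformly
distributed on the circle. Signs of their real parts would attain `√2`; the sign function being
discontinuous, odd polynomials approximate it, with an error that is a central binomial probability.
-/

open scoped ComplexOrder

/-! ### States: Cauchy–Schwarz, null vectors, unitaries acting as scalars. -/

namespace IsState

variable {A : Type*} [CStarAlgebra A] {ω : A →ₗ[ℂ] ℂ}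

theorem map_nonneg [PartialOrder A] [StarOrderedRing A] (hω : IsState ω) {a : A} (ha : 0 ≤ a) :
    0 ≤ ω a := by
  obtain ⟨b, rfl⟩ := CStarAlgebra.nonneg_iff_eq_star_mul_self.1 ha
  exact hω.nonneg b

theorem mono [PartialOrder A] [StarOrderedRing A] (hω : IsState ω) {a b : A} (h : a ≤ b) :
    ω a ≤ ω b := by
  simpa using hω.map_nonneg (sub_nonneg.2 h)

/-- A state as a bundled positive linear map. -/
def toPositive [PartialOrder A] [StarOrderedRing A] (hω : IsState ω) : A →ₚ[ℂ] ℂ :=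
  PositiveLinearMap.mk ω fun _ _ h => hω.mono h

theorem map_star (hω : IsState ω) (a : A) : ω (star a) = star (ω a) := by
  let _ := CStarAlgebra.spectralOrder A
  have _ := CStarAlgebra.spectralOrderedRing A
  exact StarHomClass.map_star hω.toPositive a

theorem continuous (hω : IsState ω) : Continuous ω := by
  let _ := CStarAlgebra.spectralOrder A
  have _ := CStarAlgebra.spectralOrderedRing A
  exact map_continuous hω.toPositive

/-- The Cauchy-Schwarz inequality, for vectors of seminorm zero. -/
theorem map_mul_eq_zero (hω : IsState ω) {t : A} (ht : ω (star t * t) = 0) (s : A) :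
    ω (s * t) = 0 := by
  let _ := CStarAlgebra.spectralOrder A
  have _ := CStarAlgebra.spectralOrderedRing A
  set f := hω.toPositive
  have h : ‖f.toPreGNS t‖ = 0 := by
    rw [f.preGNS_norm_def]
    change √(ω (star t * t)).re = 0
    simp [ht]
  have h2 := norm_inner_le_norm (𝕜 := ℂ) (f.toPreGNS (star s)) (f.toPreGNS t)
  rw [h, mul_zero, norm_le_zero_iff, f.preGNS_inner_def] at h2
  have h3 : ω (star (star s) * t) = 0 := h2
  rwa [star_star] at h3

theorem map_star_mul_eq_zero (hω : IsState ω) {t : A} (ht : ω (star t * t) = 0) (s : A) :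
    ω (star t * s) = 0 := by
  have := hω.map_star (star s * t)
  rw [hω.map_mul_eq_zero ht, star_mul, star_star, star_zero] at this
  exact this

/-- With `null_add` and `null_smul`: the null vectors form a left ideal, the kernel of the GNS
construction. -/
theorem null_mul (hω : IsState ω) {t : A} (ht : ω (star t * t) = 0) (s : A) :
    ω (star (s * t) * (s * t)) = 0 := by
  rw [← mul_assoc]
  exact hω.map_mul_eq_zero ht _

theorem null_add (hω : IsState ω) {s t : A} (hs : ω (star s * s) = 0) (ht : ω (star t * t) = 0) :
    ω (star (s + t) * (s + t)) = 0 := by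
  rw [mul_add, map_add, hω.map_mul_eq_zero hs, hω.map_mul_eq_zero ht, add_zero]

theorem null_smul (hω : IsState ω) {t : A} (ht : ω (star t * t) = 0) (c : ℂ) :
    ω (star (c • t) * (c • t)) = 0 := by
  rw [mul_smul_comm, map_smul, hω.map_mul_eq_zero ht, smul_zero]

theorem re_nonneg (hω : IsState ω) (a : A) : 0 ≤ (ω (star a * a)).re :=
  (Complex.le_def.1 (hω.nonneg a)).1

theorem coe_re_of_isSelfAdjoint (hω : IsState ω) {a : A} (ha : IsSelfAdjoint a) :
    (((ω a).re : ℝ) : ℂ) = ω a := by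
  have := hω.map_star a
  rw [ha.star_eq] at this
  exact (Complex.conj_eq_iff_re.1 this.symm)

/-- The value of a state on `a²` is at most one for a self-adjoint contraction `a`. -/
theorem re_map_mul_self_le_one (hω : IsState ω) {a : A} (ha : IsSelfAdjoint a) (h : ‖a‖ ≤ 1) :
    (ω (a * a)).re ≤ 1 := by
  let _ := CStarAlgebra.spectralOrder A
  have _ := CStarAlgebra.spectralOrderedRing A
  have hn : ‖a * a‖ ≤ 1 := (norm_mul_le a a).trans (mul_le_one₀ h (norm_nonneg _) h)
  have h1 : a * a ≤ 1 :=
    (CStarAlgebra.norm_le_one_iff_of_nonneg (a * a) (by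
      simpa [ha.star_eq] using star_mul_self_nonneg a)).1 hn
  have := hω.mono h1
  rw [hω.map_one] at this
  simpa using (Complex.le_def.1 this).1

/-- A unitary on which a state has modulus one acts as a scalar under the state. -/
theorem map_mul_of_unitary (hω : IsState ω) {u : A} (hu : u ∈ unitary A) {c : ℂ} (hc : ‖c‖ = 1)
    (h : ω u = c) (x : A) : ω (u * x) = c * ω x ∧ ω (x * u) = c * ω x := by
  have hcc : star c * c = 1 := by
    rw [Complex.star_def, Complex.conj_mul', hc]; simp
  have h' : ω (star u) = star c := by rw [hω.map_star, h]
  constructor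
  -- Both `u - c` and its adjoint are null; the adjoint serves for multiplication by `u` on the
  -- left, `u - c` itself for the right.
  · have ht : ω (star (star (u - c • 1)) * star (u - c • 1)) = 0 := by
      simp only [star_star, star_sub, star_smul, star_one, mul_sub, sub_mul, mul_smul_comm,
        smul_mul_assoc, mul_one, one_mul, map_sub, map_smul, Unitary.mul_star_self_of_mem hu,
        hω.map_one, h, h', smul_eq_mul]
      linear_combination (-1 : ℂ) * hcc
    have := hω.map_star_mul_eq_zero ht x
    simpa [sub_mul, sub_eq_zero] using this
  · have ht : ω (star (u - c • 1) * (u - c • 1)) = 0 := by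
      simp only [star_sub, star_smul, star_one, mul_sub, sub_mul, mul_smul_comm,
        smul_mul_assoc, mul_one, one_mul, map_sub, map_smul, Unitary.star_mul_self_of_mem hu,
        hω.map_one, h, h', smul_eq_mul]
      linear_combination (-1 : ℂ) * hcc
    have := hω.map_mul_eq_zero ht x
    simpa [mul_sub, sub_eq_zero] using this

end IsState

/-! ### Decay of the central binomial coefficients. -/

/-- The central binomial coefficient is at most `4 ^ n / √(2n + 1)`. -/
theorem centralBinom_sq_mul_le (n : ℕ) : n.centralBinom ^ 2 * (2 * n + 1) ≤ 16 ^ n := by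
  induction n with
  | zero => simp
  | succ n ih =>
    have h := Nat.succ_mul_centralBinom_succ n
    -- The factor `(n + 1)²` lets the recursion apply without division; what remains is `(2n + 1)(2n
    -- + 3) ≤ (2n + 2)²`.
    refine Nat.le_of_mul_le_mul_left (c := (n + 1) ^ 2) ?_ (by positivity)
    calc (n + 1) ^ 2 * ((n + 1).centralBinom ^ 2 * (2 * (n + 1) + 1))
        = ((n + 1) * (n + 1).centralBinom) ^ 2 * (2 * n + 3) := by ring
      _ = (n.centralBinom ^ 2 * (2 * n + 1)) * (4 * ((2 * n + 1) * (2 * n + 3))) := by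
          rw [h]; ring
      _ ≤ 16 ^ n * (4 * ((2 * n + 1) * (2 * n + 3))) := Nat.mul_le_mul_right _ ih
      _ ≤ 16 ^ n * (4 * (4 * (n + 1) ^ 2)) := by
          refine Nat.mul_le_mul_left _ (Nat.mul_le_mul_left _ ?_)
          nlinarith
      _ = (n + 1) ^ 2 * 16 ^ (n + 1) := by ring

/-- The central binomial coefficients are `o(4 ^ n)`. -/
theorem tendsto_centralBinom_div_four_pow :
    Filter.Tendsto (fun n : ℕ => (n.centralBinom : ℝ) / 4 ^ n) Filter.atTop (nhds 0) := by
  have h : ∀ n : ℕ, (n.centralBinom : ℝ) / 4 ^ n ≤ √(1 / ((n : ℝ) + 1)) := fun n => by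
    refine Real.le_sqrt_of_sq_le ?_
    have h1 : ((n.centralBinom : ℝ)) ^ 2 * (2 * n + 1) ≤ 16 ^ n := by
      exact_mod_cast centralBinom_sq_mul_le n
    have h2 : ((4 : ℝ) ^ n) ^ 2 = 16 ^ n := by rw [← pow_mul, mul_comm, pow_mul]; norm_num
    rw [div_pow, h2, div_le_div_iff₀ (by positivity) (by positivity)]
    nlinarith [sq_nonneg (n.centralBinom : ℝ), (Nat.cast_nonneg n : (0 : ℝ) ≤ n),
      mul_nonneg (sq_nonneg (n.centralBinom : ℝ)) (Nat.cast_nonneg n : (0 : ℝ) ≤ n)]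
  refine squeeze_zero (fun n => by positivity) h ?_
  simpa using (tendsto_one_div_add_atTop_nhds_zero_nat (𝕜 := ℝ)).sqrt

/-! ### Odd polynomial approximations of the sign function. -/

/-- The iterates of `x ↦ (3x - x³)/2`, which approximate the sign function on `[-1, 1]`. -/
noncomputable def signIter {A : Type*} [Ring A] [Algebra ℂ A] (a : A) : ℕ → A
  | 0 => a
  | k + 1 => (3 / 2 : ℂ) • signIter a k - (1 / 2 : ℂ) • signIter a k ^ 3

/-- The real functions underlying `signIter`. -/
noncomputable def signFun : ℕ → ℝ → ℝ
  | 0, x => x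
  | k + 1, x => (3 / 2 : ℝ) * signFun k x - (1 / 2 : ℝ) * signFun k x ^ 3

theorem continuous_signFun (k : ℕ) : Continuous (signFun k) := by
  induction k with
  | zero => exact continuous_id
  | succ k ih =>
    exact (continuous_const.mul ih).sub (continuous_const.mul (ih.pow 3))

/-- The defect `y = 1 - s²` evolves by `y ↦ y²(3 + y)/4 ≤ y²`, so it is at least squared at each
iteration. -/
theorem one_sub_signFun_sq (k : ℕ) {x : ℝ} (hx : x ^ 2 ≤ 1) :
    0 ≤ 1 - signFun k x ^ 2 ∧ 1 - signFun k x ^ 2 ≤ (1 - x ^ 2) ^ 2 ^ k := by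
  induction k with
  | zero => simpa [signFun] using hx
  | succ k ih =>
    obtain ⟨h0, h1⟩ := ih
    set y := 1 - signFun k x ^ 2 with hy
    have e : 1 - signFun (k + 1) x ^ 2 = y * y * (3 + y) / 4 := by
      simp only [signFun, hy]; ring
    have hy1 : y ≤ 1 := by simp only [hy]; nlinarith [sq_nonneg (signFun k x)]
    rw [e]
    refine ⟨by positivity, ?_⟩
    have : (1 - x ^ 2) ^ 2 ^ (k + 1) = (1 - x ^ 2) ^ 2 ^ k * (1 - x ^ 2) ^ 2 ^ k := by
      rw [← pow_add]; congr 1; ring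
    rw [this]
    calc y * y * (3 + y) / 4 ≤ y * y := by nlinarith [mul_nonneg h0 h0]
      _ ≤ _ := mul_le_mul h1 h1 h0 (h0.trans h1)

section

variable {A : Type*} [CStarAlgebra A]

/-- Transfers the scalar bounds to operators. The algebraic definition is kept for membership in
subalgebras that need not be closed and for (anti)commutation, both by induction. -/
theorem signIter_eq_cfc {a : A} (ha : IsSelfAdjoint a) (k : ℕ) :
    signIter a k = cfc (signFun k) a := by
  induction k with
  | zero => exact (cfc_id ℝ a).symm
  | succ k ih =>
    have hc := (continuous_signFun k).continuousOn (s := spectrum ℝ a)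
    have hc3 : ContinuousOn (fun x => signFun k x ^ 3) (spectrum ℝ a) := hc.pow 3
    have e : signFun (k + 1) = fun x => (3 / 2 : ℝ) * signFun k x - (1 / 2 : ℝ) * signFun k x ^ 3 :=
      rfl
    rw [e, cfc_sub _ _ a (hc.const_mul _) (hc3.const_mul _), cfc_const_mul _ _ a hc,
      cfc_const_mul _ _ a hc3, cfc_pow _ 3 a hc, ← ih, signIter]
    simp only [← Complex.coe_smul]
    norm_num

theorem spectrum_sq_le_one {a : A} (h : ‖a‖ ≤ 1) {x : ℝ} (hx : x ∈ spectrum ℝ a) : x ^ 2 ≤ 1 := by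
  have : ‖x‖ ≤ 1 := by
    cases subsingleton_or_nontrivial A
    · simp [spectrum.of_subsingleton] at hx
    exact (spectrum.norm_le_norm_of_mem hx).trans h
  rw [sq_le_one_iff_abs_le_one]
  exact this

theorem isSelfAdjoint_signIter {a : A} (ha : IsSelfAdjoint a) (k : ℕ) :
    IsSelfAdjoint (signIter a k) := by
  rw [signIter_eq_cfc ha]
  exact cfc_predicate _ a

theorem norm_signIter_le {a : A} (ha : IsSelfAdjoint a) (h : ‖a‖ ≤ 1) (k : ℕ) :
    ‖signIter a k‖ ≤ 1 := by
  rw [signIter_eq_cfc ha]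
  refine norm_cfc_le zero_le_one fun x hx => ?_
  have := (one_sub_signFun_sq k (spectrum_sq_le_one h hx)).1
  rw [Real.norm_eq_abs, ← sq_le_one_iff_abs_le_one]
  linarith

theorem one_sub_signIter_sq_le [PartialOrder A] [StarOrderedRing A] {a : A}
    (ha : IsSelfAdjoint a) (h : ‖a‖ ≤ 1) (k : ℕ) :
    1 - signIter a k * signIter a k ≤ (1 - a * a) ^ 2 ^ k := by
  have hc := (continuous_signFun k).continuousOn (s := spectrum ℝ a)
  have e1 : 1 - signIter a k * signIter a k = cfc (fun x => 1 - signFun k x ^ 2) a := by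
    rw [cfc_sub (fun _ => (1 : ℝ)) (fun x => signFun k x ^ 2) a (by fun_prop) (hc.pow 2),
      cfc_const_one ℝ a, cfc_pow _ 2 a hc, ← signIter_eq_cfc ha, sq]
  have e2 : (1 - a * a) ^ 2 ^ k = cfc (fun x : ℝ => (1 - x ^ 2) ^ 2 ^ k) a := by
    rw [cfc_pow (fun x : ℝ => 1 - x ^ 2) _ a (by fun_prop),
      cfc_sub (fun _ => (1 : ℝ)) (fun x => x ^ 2) a (by fun_prop) (by fun_prop),
      cfc_const_one ℝ a, cfc_pow_id a 2, sq]
  rw [e1, e2]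
  refine cfc_mono (fun x hx => (one_sub_signFun_sq k (spectrum_sq_le_one h hx)).2)
    (continuousOn_const.sub (hc.pow 2)) (by fun_prop)

theorem signIter_mem (S : StarSubalgebra ℂ A) {a : A} (ha : a ∈ S) (k : ℕ) : signIter a k ∈ S := by
  induction k with
  | zero => exact ha
  | succ k ih => exact sub_mem (S.smul_mem ih _) (S.smul_mem (pow_mem ih 3) _)

theorem signIter_commute {a b : A} (h : Commute a b) (k j : ℕ) :
    Commute (signIter a k) (signIter b j) := by
  have key : ∀ {a b : A}, Commute a b → ∀ k, Commute (signIter a k) b := fun {a b} h k => by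
    induction k with
    | zero => exact h
    | succ k ih => exact (ih.smul_left _).sub_left ((ih.pow_left 3).smul_left _)
  exact key (key h.symm j).symm k

/-- Holds because the polynomials are odd: an odd power of `a` picks up one sign when moved past
`b`. -/
theorem signIter_anticommute {a b : A} (h : a * b = -(b * a)) (k j : ℕ) :
    signIter a k * signIter b j = -(signIter b j * signIter a k) := by
  have key : ∀ {a b : A}, a * b = -(b * a) → ∀ k, signIter a k * b = -(b * signIter a k) :=
    fun {a b} h k => by
      induction k with
      | zero => exact h
      | succ k ih =>
        have h3 : signIter a k ^ 3 * b = -(b * signIter a k ^ 3) := by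
          calc signIter a k ^ 3 * b = signIter a k * (signIter a k * (signIter a k * b)) := by
                noncomm_ring
            _ = _ := by
                rw [ih, mul_neg, ← mul_assoc (signIter a k) b, ih, neg_mul, neg_neg,
                  ← mul_assoc, ← mul_assoc, ih]
                noncomm_ring
        simp only [signIter, sub_mul, mul_sub, smul_mul_assoc, mul_smul_comm, ih, h3, smul_neg]
        abel
  have h1 := key h k
  have h2 := key (a := b) (b := signIter a k) (by rw [h1, neg_neg]) j
  rw [h2, neg_neg]

end

/-! ### Tsirelson's bound and Bell operators that approach it. -/

section

variable {A : Type*} [CStarAlgebra A]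

namespace IsState

variable {ω : A →ₗ[ℂ] ℂ}

/-- Tsirelson's bound: a state is at most `√2` on a Bell operator for commuting subalgebras. -/
theorem le_sqrt_two_of_mem_bellOperators (hω : IsState ω) {A₁ A₂ : StarSubalgebra ℂ A}
    (hcomm : ∀ a ∈ A₁, ∀ b ∈ A₂, Commute a b) {R : A} (hR : R ∈ bellOperators A₁ A₂) {x : ℝ}
    (hx : ω R = x) : x ≤ √2 := by
  obtain ⟨a₁, ha₁, a₂, ha₂, b₁, hb₁, b₂, hb₂, ⟨sa₁, na₁⟩, ⟨sa₂, na₂⟩, ⟨sb₁, nb₁⟩, ⟨sb₂, nb₂⟩,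
    rfl⟩ := hR
  set r : ℂ := ((√2 / 2 : ℝ) : ℂ) with hr
  have hrr : r * r = 1 / 2 := by
    rw [hr, ← Complex.ofReal_mul, div_mul_div_comm, Real.mul_self_sqrt zero_le_two]
    norm_num
  have c11 := (hcomm a₁ ha₁ b₁ hb₁).eq
  have c12 := (hcomm a₁ ha₁ b₂ hb₂).eq
  have c21 := (hcomm a₂ ha₂ b₁ hb₁).eq
  have c22 := (hcomm a₂ ha₂ b₂ hb₂).eq
  have hstar : star r = r := Complex.conj_ofReal _
  have h1 := hω.re_nonneg (a₁ - r • (b₁ + b₂))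
  have h2 := hω.re_nonneg (a₂ - r • (b₁ - b₂))
  -- With `r = 1/√2` the cross terms in the `bᵢ` cancel, and a sum of squares equals `∑ aᵢ² + ∑ bᵢ²
  -- - 2√2 R`. A state is at most 4 on the first two sums, whence `2√2 x ≤ 4`.
  have e : star (a₁ - r • (b₁ + b₂)) * (a₁ - r • (b₁ + b₂)) +
      star (a₂ - r • (b₁ - b₂)) * (a₂ - r • (b₁ - b₂)) =
      a₁ * a₁ + a₂ * a₂ + b₁ * b₁ + b₂ * b₂ -
        (4 * r) • (1 / 2 : ℂ) • (a₁ * (b₁ + b₂) + a₂ * (b₁ - b₂)) := by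
    simp only [star_sub, star_smul, star_add, sa₁.star_eq, sa₂.star_eq, sb₁.star_eq, sb₂.star_eq,
      hstar, mul_add, add_mul, mul_sub, sub_mul, smul_mul_assoc, mul_smul_comm, ← c11, ← c12,
      ← c21, ← c22]
    match_scalars <;> first | linear_combination (2 : ℂ) * hrr | ring
  have e2 := congrArg (fun z => (ω z).re) e
  simp only [map_add, map_sub, Complex.add_re, Complex.sub_re] at e2
  rw [map_smul, hx] at e2
  have e3 : ((4 * r) • (x : ℂ)).re = 2 * √2 * x := by
    rw [hr, smul_eq_mul]
    norm_cast
    ring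
  rw [e3] at e2
  have s2 : √2 * √2 = 2 := Real.mul_self_sqrt zero_le_two
  have p := Real.sqrt_pos.2 (zero_lt_two (α := ℝ))
  have := hω.re_map_mul_self_le_one sa₁ na₁
  have := hω.re_map_mul_self_le_one sa₂ na₂
  have := hω.re_map_mul_self_le_one sb₁ nb₁
  have := hω.re_map_mul_self_le_one sb₂ nb₂
  have : √2 * x ≤ √2 * √2 := by linarith
  exact le_of_mul_le_mul_left this p

end IsState

/-- The real part of an element. -/
noncomputable def reHalf (u : A) : A := (1 / 2 : ℂ) • (u + star u)

theorem isSelfAdjoint_reHalf (u : A) : IsSelfAdjoint (reHalf u) := by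
  rw [isSelfAdjoint_iff, reHalf, star_smul, star_add, star_star, add_comm]
  norm_num

theorem norm_reHalf_le {u : A} (hu : u ∈ unitary A) : ‖reHalf u‖ ≤ 1 := by
  have h1 : ‖u‖ ≤ 1 := by
    cases subsingleton_or_nontrivial A
    · simp [Subsingleton.elim u 0]
    · exact (CStarRing.norm_of_mem_unitary hu).le
  have := norm_add_le u (star u)
  rw [norm_star] at this
  rw [reHalf, norm_smul]
  norm_num
  linarith

theorem reHalf_mem (S : StarSubalgebra ℂ A) {u : A} (hu : u ∈ S) : reHalf u ∈ S :=
  S.smul_mem (add_mem hu (star_mem hu)) _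

/-- For a unitary the adjoint is the inverse, so anticommutation passes to adjoints and then to real
parts. -/
theorem reHalf_anticommute {u v : A} (hu : u ∈ unitary A) (hv : v ∈ unitary A)
    (h : u * v = -(v * u)) : reHalf u * reHalf v = -(reHalf v * reHalf u) := by
  have h1 : star v * star u = -(star u * star v) := by
    simpa using congrArg star h
  have key : ∀ {u v : A}, v ∈ unitary A → u * v = -(v * u) → u * star v = -(star v * u) :=
    fun {u v} hv h => by
      calc u * star v = star v * (v * u) * star v := by
            rw [← mul_assoc, Unitary.star_mul_self_of_mem hv, one_mul]
        _ = -(star v * u) := by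
            rw [← neg_eq_iff_eq_neg.2 h, mul_neg, neg_mul, mul_assoc, mul_assoc,
              Unitary.mul_star_self_of_mem hv, mul_one]
  have h2 := key hv h
  have h3 := key hu (neg_eq_iff_eq_neg.1 h.symm : v * u = -(u * v))
  simp only [reHalf, smul_mul_assoc, mul_smul_comm, mul_add, add_mul, h, h2, h1, h3, smul_add,
    smul_neg]
  abel

/-- Since `1 - (Re u)² = -(u - u*)²/4`, this is the binomial theorem for the commuting pair `u`,
`-u*`. -/
theorem one_sub_reHalf_sq_pow {u : A} (hu : u ∈ unitary A) (n : ℕ) :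
    (1 - reHalf u * reHalf u) ^ n = ((-1) ^ n / 4 ^ n : ℂ) •
      ∑ j ∈ Finset.range (2 * n + 1),
        ((-1) ^ (2 * n - j) * ((2 * n).choose j : ℂ)) • (u ^ j * star u ^ (2 * n - j)) := by
  have h1 := Unitary.mul_star_self_of_mem hu
  have h2 := Unitary.star_mul_self_of_mem hu
  have e : 1 - reHalf u * reHalf u = (-1 / 4 : ℂ) • (u + -star u) ^ 2 := by
    simp only [reHalf, smul_mul_assoc, mul_smul_comm, mul_add, add_mul, h1, h2, sq, mul_neg,
      neg_mul]
    match_scalars <;> norm_num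
  have hc : Commute u (-star u) := Commute.neg_right (h1.trans h2.symm)
  rw [e, smul_pow, ← pow_mul, div_pow, hc.add_pow]
  congr 1
  refine Finset.sum_congr rfl fun j _ => ?_
  rw [← neg_one_smul ℂ (star u), smul_pow, mul_smul_comm, ← nsmul_eq_mul',
    ← Nat.cast_smul_eq_nsmul ℂ, smul_smul, mul_comm]

namespace IsState

variable {ω : A →ₗ[ℂ] ℂ}

/-- The hypothesis says that `u` is uniformly distributed on the circle; the value is the mean of
`sin²ⁿ`, only the middle binomial term surviving. -/
theorem map_one_sub_reHalf_sq_pow (hω : IsState ω) {u : A} (hu : u ∈ unitary A)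
    (h0 : ∀ i j : ℕ, i ≠ j → ω (u ^ i * star u ^ j) = 0) (n : ℕ) :
    ω ((1 - reHalf u * reHalf u) ^ n) = ((n.centralBinom : ℝ) / 4 ^ n : ℝ) := by
  rw [one_sub_reHalf_sq_pow hu, map_smul, map_sum, Finset.sum_eq_single n]
  · have : u ^ n * star u ^ n = 1 := by
      rw [← star_pow]; exact Unitary.mul_star_self_of_mem (pow_mem hu n)
    rw [map_smul, two_mul, Nat.add_sub_cancel, this, hω.map_one, ← two_mul,
      ← Nat.centralBinom_eq_two_mul_choose]
    have h2 : (-1 : ℂ) ^ n * (-1) ^ n = 1 := by rw [← mul_pow]; simp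
    push_cast
    simp only [smul_eq_mul, mul_one]
    rw [div_mul_eq_mul_div, ← mul_assoc, h2, one_mul]
  · intro j _ hj
    rw [map_smul, h0 _ _ (by omega), smul_zero]
  · intro h; simp at h; omega

theorem one_sub_le_re_map_signIter_sq (hω : IsState ω) {u : A} (hu : u ∈ unitary A)
    (h0 : ∀ i j : ℕ, i ≠ j → ω (u ^ i * star u ^ j) = 0) (k : ℕ) :
    1 - ((2 ^ k).centralBinom : ℝ) / 4 ^ 2 ^ k ≤
      (ω (signIter (reHalf u) k * signIter (reHalf u) k)).re := by
  let _ := CStarAlgebra.spectralOrder A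
  have _ := CStarAlgebra.spectralOrderedRing A
  have := hω.mono (one_sub_signIter_sq_le (isSelfAdjoint_reHalf u) (norm_reHalf_le hu) k)
  rw [hω.map_one_sub_reHalf_sq_pow hu h0, map_sub, hω.map_one] at this
  have := (Complex.le_def.1 this).1
  rw [Complex.sub_re, Complex.one_re, Complex.ofReal_re] at this
  linarith

/-- If `ω (u u') = 1` for commuting unitaries then the real parts of `u`, `u'` agree in the GNS
representation. -/
theorem null_reHalf_sub (hω : IsState ω) {u u' : A} (hu : u ∈ unitary A) (hu' : u' ∈ unitary A)
    (hc : Commute u u') (h : ω (u * u') = 1) :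
    ω (star (reHalf u - reHalf u') * (reHalf u - reHalf u')) = 0 := by
  have h' : ω (star u' * star u) = 1 := by rw [← star_mul, hω.map_star, h, star_one]
  -- Equality in Cauchy–Schwarz: `ω (u u') = 1` makes `u - u'*` null, and likewise `u* - u'`.
  have h1 : ω (star (u - star u') * (u - star u')) = 0 := by
    simp only [star_sub, star_star, mul_sub, sub_mul, map_sub, Unitary.star_mul_self_of_mem hu,
      Unitary.mul_star_self_of_mem hu', hω.map_one, ← hc.eq, h, hc.star_star.eq, h']
    ring
  have h2 : ω (star (star u - u') * (star u - u')) = 0 := by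
    simp only [star_sub, star_star, mul_sub, sub_mul, map_sub, Unitary.mul_star_self_of_mem hu,
      Unitary.star_mul_self_of_mem hu', hω.map_one, h, h']
    ring
  have e : reHalf u - reHalf u' = (1 / 2 : ℂ) • ((u - star u') + (star u - u')) := by
    simp only [reHalf]; module
  rw [e]
  exact hω.null_smul (hω.null_add h1 h2) _

/-- For commuting `x`, `y` the difference `x³ - y³` is a left multiple of `x - y`, and null vectors
form a left ideal. -/
theorem null_signIter_sub (hω : IsState ω) {a b : A} (hc : Commute a b)
    (h : ω (star (a - b) * (a - b)) = 0) (k : ℕ) :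
    ω (star (signIter a k - signIter b k) * (signIter a k - signIter b k)) = 0 := by
  induction k with
  | zero => exact h
  | succ k ih =>
    have hk := (signIter_commute hc k k).eq
    set x := signIter a k
    set y := signIter b k
    have e : signIter a (k + 1) - signIter b (k + 1) =
        (3 / 2 : ℂ) • (x - y) + (-(1 / 2) : ℂ) • ((x * x + x * y + y * y) * (x - y)) := by
      have : (x * x + x * y + y * y) * (x - y) = x ^ 3 - y ^ 3 := by
        have h1 : x * y * x = x * x * y := by rw [mul_assoc, ← hk, mul_assoc]
        have h2 : y * y * x = x * y * y := by rw [mul_assoc, ← hk, ← mul_assoc, ← hk]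
        simp only [mul_sub, add_mul, h1, h2, pow_succ, pow_zero, one_mul]
        abel
      rw [this]
      simp only [signIter]
      module
    rw [e]
    exact hω.null_add (hω.null_smul ih _) (hω.null_smul (hω.null_mul ih _) _)

/-- Two pairs of anticommuting unitaries that are perfectly correlated in a state, and whose
distributions are uniform, give Bell operators with values arbitrarily close to `√2`. -/
theorem isMaximallyBellCorrelated_of_anticommute (hω : IsState ω) {A₁ A₂ : StarSubalgebra ℂ A}
    (hcomm : ∀ a ∈ A₁, ∀ b ∈ A₂, Commute a b) {u v u' v' : A}
    (hu : u ∈ unitary A) (hv : v ∈ unitary A) (hu' : u' ∈ unitary A) (hv' : v' ∈ unitary A)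
    (mu : u ∈ A₁) (mv : v ∈ A₁) (mu' : u' ∈ A₂) (mv' : v' ∈ A₂)
    (anti' : u' * v' = -(v' * u')) (huu' : ω (u * u') = 1) (hvv' : ω (v * v') = 1)
    (hu0 : ∀ i j : ℕ, i ≠ j → ω (u ^ i * star u ^ j) = 0)
    (hv0 : ∀ i j : ℕ, i ≠ j → ω (v ^ i * star v ^ j) = 0) :
    IsMaximallyBellCorrelated ω A₁ A₂ := by
  refine ⟨?_, fun B hB => ?_⟩
  · rintro x ⟨R, hR, hx⟩
    exact hω.le_sqrt_two_of_mem_bellOperators hcomm hR hx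
  have key : ∀ k : ℕ, √2 * (1 - ((2 ^ k).centralBinom : ℝ) / 4 ^ 2 ^ k) ≤ B := fun k => by
    set a₁ := signIter (reHalf u) k with ha₁
    set a₂ := signIter (reHalf v) k with ha₂
    set c₁ := signIter (reHalf u') k with hc₁
    set c₂ := signIter (reHalf v') k with hc₂
    have sc₁ : IsSelfAdjoint c₁ := isSelfAdjoint_signIter (isSelfAdjoint_reHalf _) k
    have sc₂ : IsSelfAdjoint c₂ := isSelfAdjoint_signIter (isSelfAdjoint_reHalf _) k
    have nc₁ : ‖c₁‖ ≤ 1 := norm_signIter_le (isSelfAdjoint_reHalf _) (norm_reHalf_le hu') k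
    have nc₂ : ‖c₂‖ ≤ 1 := norm_signIter_le (isSelfAdjoint_reHalf _) (norm_reHalf_le hv') k
    have sa₁ : IsSelfAdjoint a₁ := isSelfAdjoint_signIter (isSelfAdjoint_reHalf _) k
    have sa₂ : IsSelfAdjoint a₂ := isSelfAdjoint_signIter (isSelfAdjoint_reHalf _) k
    have hanti : c₁ * c₂ = -(c₂ * c₁) :=
      signIter_anticommute (reHalf_anticommute hu' hv' anti') k k
    have mc₁ : c₁ ∈ A₂ := signIter_mem A₂ (reHalf_mem A₂ mu') k
    have mc₂ : c₂ ∈ A₂ := signIter_mem A₂ (reHalf_mem A₂ mv') k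
    set r : ℂ := ((√2 / 2 : ℝ) : ℂ) with hr
    have hrr : r * r = 1 / 2 := by
      rw [hr, ← Complex.ofReal_mul, div_mul_div_comm, Real.mul_self_sqrt zero_le_two]
      norm_num
    have hstar : star r = r := Complex.conj_ofReal _
    have hsq : ‖c₁ * c₁ + c₂ * c₂‖ ≤ 2 := by
      refine (norm_add_le _ _).trans ?_
      have := (norm_mul_le c₁ c₁).trans (mul_le_one₀ nc₁ (norm_nonneg _) nc₁)
      have := (norm_mul_le c₂ c₂).trans (mul_le_one₀ nc₂ (norm_nonneg _) nc₂)
      linarith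
    -- Anticommutation removes the cross terms: both `(c₁ ± c₂)/√2` have square `(c₁² + c₂²)/2`,
    -- hence are contractions.
    have norm_le : ∀ b : A, IsSelfAdjoint b → b * b = (1 / 2 : ℂ) • (c₁ * c₁ + c₂ * c₂) →
        ‖b‖ ≤ 1 := fun b hb e => by
      have h1 := CStarRing.norm_star_mul_self (x := b)
      rw [hb.star_eq, e, norm_smul] at h1
      norm_num at h1
      nlinarith [norm_nonneg b]
    have sb₁ : IsSelfAdjoint (r • (c₁ + c₂)) := by
      rw [isSelfAdjoint_iff, star_smul, hstar, (sc₁.add sc₂).star_eq]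
    have sb₂ : IsSelfAdjoint (r • (c₁ - c₂)) := by
      rw [isSelfAdjoint_iff, star_smul, hstar, (sc₁.sub sc₂).star_eq]
    have nb₁ : ‖r • (c₁ + c₂)‖ ≤ 1 := norm_le _ sb₁ (by
      rw [smul_mul_smul_comm, hrr, add_mul, mul_add, mul_add, hanti]; module)
    have nb₂ : ‖r • (c₁ - c₂)‖ ≤ 1 := norm_le _ sb₂ (by
      rw [smul_mul_smul_comm, hrr, sub_mul, mul_sub, mul_sub, hanti]; module)
    have sq_sa : ∀ {a : A}, IsSelfAdjoint a → IsSelfAdjoint (a * a) := fun {a} h => by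
      rw [isSelfAdjoint_iff, star_mul, h.star_eq]
    -- Perfect correlation lets the partner in `A₂` be replaced by the element of `A₁`.
    have double : ∀ {u u' : A}, u ∈ unitary A → u' ∈ unitary A → u ∈ A₁ → u' ∈ A₂ →
        ω (u * u') = 1 → ω (signIter (reHalf u) k * signIter (reHalf u') k) =
          ω (signIter (reHalf u) k * signIter (reHalf u) k) :=
      fun {u u'} hu hu' mu mu' h => by
        have := hω.map_mul_eq_zero (hω.null_signIter_sub
          (hcomm _ (reHalf_mem A₁ mu) _ (reHalf_mem A₂ mu'))
          (hω.null_reHalf_sub hu hu' (hcomm _ mu _ mu') h) k) (signIter (reHalf u) k)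
        rw [mul_sub, map_sub, sub_eq_zero] at this
        exact this.symm
    have d₁ := double hu hu' mu mu' huu'
    have d₂ := double hv hv' mv mv' hvv'
    rw [← ha₁, ← hc₁] at d₁
    rw [← ha₂, ← hc₂] at d₂
    have hR : ω ((1 / 2 : ℂ) • (a₁ * (r • (c₁ + c₂) + r • (c₁ - c₂)) +
        a₂ * (r • (c₁ + c₂) - r • (c₁ - c₂)))) =
        ((√2 / 2 * ((ω (a₁ * a₁)).re + (ω (a₂ * a₂)).re) : ℝ) : ℂ) := by
      -- With `bᵢ = (c₁ ± c₂)/√2` the Bell operator collapses to `(a₁c₁ + a₂c₂)/√2`.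
      have e : (1 / 2 : ℂ) • (a₁ * (r • (c₁ + c₂) + r • (c₁ - c₂)) +
        a₂ * (r • (c₁ + c₂) - r • (c₁ - c₂))) = r • (a₁ * c₁ + a₂ * c₂) := by
        simp only [mul_add, mul_sub, mul_smul_comm]
        module
      rw [e, map_smul, map_add, d₁, d₂, Complex.ofReal_mul, Complex.ofReal_add,
        hω.coe_re_of_isSelfAdjoint (sq_sa sa₁), hω.coe_re_of_isSelfAdjoint (sq_sa sa₂), smul_eq_mul]
    have hle := hB ⟨_, ⟨a₁, signIter_mem A₁ (reHalf_mem A₁ mu) k, a₂,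
      signIter_mem A₁ (reHalf_mem A₁ mv) k, r • (c₁ + c₂), A₂.smul_mem (add_mem mc₁ mc₂) r,
      r • (c₁ - c₂), A₂.smul_mem (sub_mem mc₁ mc₂) r,
      ⟨sa₁, norm_signIter_le (isSelfAdjoint_reHalf _) (norm_reHalf_le hu) k⟩,
      ⟨sa₂, norm_signIter_le (isSelfAdjoint_reHalf _) (norm_reHalf_le hv) k⟩,
      ⟨sb₁, nb₁⟩, ⟨sb₂, nb₂⟩, rfl⟩, hR⟩
    have l₁ := hω.one_sub_le_re_map_signIter_sq hu hu0 k
    have l₂ := hω.one_sub_le_re_map_signIter_sq hv hv0 k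
    nlinarith [Real.sqrt_nonneg 2]
  refine le_of_tendsto' (x := Filter.atTop) ?_ key
  have := tendsto_centralBinom_div_four_pow.comp
    (tendsto_pow_atTop_atTop_of_one_lt (one_lt_two (α := ℕ)))
  simpa using (this.const_sub 1).const_mul √2

end IsState

end

/-! ### Extending a character to a state. -/

/-- A contractive unital functional on a C*-algebra is a state. -/
theorem isState_of_norm_le {A : Type*} [CStarAlgebra A] {f : A →ₗ[ℂ] ℂ} (h1 : f 1 = 1)
    (hf : ∀ a, ‖f a‖ ≤ ‖a‖) : IsState f := by
  let _ := CStarAlgebra.spectralOrder A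
  have _ := CStarAlgebra.spectralOrderedRing A
  have hone : ‖(1 : A)‖ ≤ 1 := by
    cases subsingleton_or_nontrivial A
    · simp [Subsingleton.elim (1 : A) 0]
    · exact CStarRing.norm_one.le
  have him : ∀ a : A, IsSelfAdjoint a → (f a).im = 0 := fun a ha => by
    -- Evaluating at `a + it`: the `t²` cancel, so a nonzero imaginary part would leave a term
    -- linear in `t` bounded for all `t`.
    have key : ∀ t : ℝ, ((f a).im + t) ^ 2 ≤ ‖a‖ ^ 2 + t ^ 2 := fun t => by
      have e : star (a + (t * Complex.I : ℂ) • (1 : A)) * (a + (t * Complex.I : ℂ) • (1 : A)) =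
          a * a + ((t : ℂ) ^ 2) • (1 : A) := by
        simp only [star_add, star_smul, ha.star_eq, star_one, mul_add, add_mul, smul_mul_assoc,
          mul_smul_comm, mul_one, one_mul, Complex.star_def, map_mul, Complex.conj_I,
          Complex.conj_ofReal]
        match_scalars
        · ring
        · ring
        · linear_combination (-(t : ℂ) ^ 2) * Complex.I_sq
      have hn : ‖a + (t * Complex.I : ℂ) • (1 : A)‖ ^ 2 ≤ ‖a‖ ^ 2 + t ^ 2 := by
        rw [sq, ← CStarRing.norm_star_mul_self, e, sq ‖a‖]
        refine (norm_add_le _ _).trans (add_le_add (norm_mul_le _ _) ?_)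
        rw [norm_smul, norm_pow, Complex.norm_real, Real.norm_eq_abs, sq_abs]
        exact mul_le_of_le_one_right (sq_nonneg t) hone
      have hfa := hf (a + (t * Complex.I : ℂ) • (1 : A))
      have him : (f (a + (t * Complex.I : ℂ) • (1 : A))).im = (f a).im + t := by
        simp [h1]
      have := Complex.abs_im_le_norm (f (a + (t * Complex.I : ℂ) • (1 : A)))
      rw [him] at this
      calc ((f a).im + t) ^ 2 = |(f a).im + t| ^ 2 := (sq_abs _).symm
        _ ≤ ‖a + (t * Complex.I : ℂ) • (1 : A)‖ ^ 2 := by gcongr; exact this.trans hfa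
        _ ≤ _ := hn
    by_contra hne
    have h2 := key ((‖a‖ ^ 2 + 1) / (2 * (f a).im))
    have h3 : 2 * (f a).im * ((‖a‖ ^ 2 + 1) / (2 * (f a).im)) = ‖a‖ ^ 2 + 1 := by
      field_simp
    nlinarith [sq_nonneg (f a).im]
  refine ⟨h1, fun a => ?_⟩
  set p := star a * a with hp
  have hp0 : 0 ≤ p := star_mul_self_nonneg a
  have hsa : IsSelfAdjoint p := .of_nonneg hp0
  -- For `p ≥ 0` contractivity at `‖p‖ - p` forces `‖p‖ - Re f(p) ≤ ‖p‖`.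
  have hn : ‖algebraMap ℝ A ‖p‖ - p‖ ≤ ‖p‖ := by
    rw [CStarAlgebra.norm_le_iff_le_algebraMap _ (norm_nonneg p)
      (sub_nonneg.2 hsa.le_algebraMap_norm_self)]
    exact sub_le_self _ hp0
  have e : f (algebraMap ℝ A ‖p‖ - p) = ‖p‖ - f p := by
    rw [map_sub, Algebra.algebraMap_eq_smul_one, ← Complex.coe_smul, map_smul, h1, smul_eq_mul,
      mul_one]
  have h4 := (Complex.re_le_norm _).trans ((hf _).trans hn)
  rw [e, Complex.sub_re, Complex.ofReal_re] at h4
  exact Complex.le_def.2 ⟨by simpa using h4, by simp [him p hsa]⟩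

namespace MonoidAlgebra

/-- Powers in the algebra of a commutative monoid have supports of polynomial growth. -/
theorem card_support_coeff_pow_le {k M : Type*} [Semiring k] [CommMonoid M]
    (x : MonoidAlgebra k M) (n : ℕ) :
    (x ^ n).coeff.support.card ≤ (n + 1) ^ x.coeff.support.card := by
  classical
  set s := x.coeff.support with hs
  -- By commutativity a product of `n` elements of `s` depends only on the multiplicities, each at
  -- most `n`.
  have key : ∀ n, (x ^ n).coeff.support ⊆
      (Fintype.piFinset fun _ : s => Finset.range (n + 1)).image
        fun m => ∏ i : s, (i : M) ^ m i := fun n => by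
    induction n with
    | zero =>
      intro g hg
      rw [pow_zero] at hg
      have := support_coeff_one_subset hg
      rw [Finset.mem_one] at this
      exact Finset.mem_image.2 ⟨fun _ => 0, by simp, by simp [this]⟩
    | succ n ih =>
      intro g hg
      rw [pow_succ] at hg
      obtain ⟨a, ha, b, hb, rfl⟩ := Finset.mem_mul.1 (support_coeff_mul_subset _ _ hg)
      obtain ⟨m, hm, rfl⟩ := Finset.mem_image.1 (ih ha)
      refine Finset.mem_image.2 ⟨fun i => m i + if i = ⟨b, hb⟩ then 1 else 0, ?_, ?_⟩
      · rw [Fintype.mem_piFinset] at hm ⊢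
        intro i
        have := Finset.mem_range.1 (hm i)
        rw [Finset.mem_range]
        split_ifs <;> omega
      · simp only [pow_add, Finset.prod_mul_distrib, pow_ite, pow_one, pow_zero]
        rw [Finset.prod_ite_eq' Finset.univ (⟨b, hb⟩ : s) (fun i => (i : M))]
        simp
  refine (Finset.card_le_card (key n)).trans (Finset.card_image_le.trans ?_)
  simp [Fintype.card_piFinset]

/-- A unitary character of a commutative monoid is dominated by the norm in every
representation for which the norm dominates the `ℓ²` norm of the coefficients. -/
theorem norm_character_le {M B : Type*} [CommMonoid M] [NormedRing B] [NormedAlgebra ℂ B]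
    (Φ : MonoidAlgebra ℂ M →ₐ[ℂ] B) (χ : MonoidAlgebra ℂ M →ₐ[ℂ] ℂ)
    (hχ : ∀ g, ‖χ (single g 1)‖ ≤ 1)
    (hΦ : ∀ x, ∑ g ∈ x.coeff.support, ‖x.coeff g‖ ^ 2 ≤ ‖Φ x‖ ^ 2) (x : MonoidAlgebra ℂ M) :
    ‖χ x‖ ≤ ‖Φ x‖ := by
  -- Cauchy–Schwarz loses the size of the support. Applied to `x ^ n` the loss is polynomial in `n`,
  -- which cannot offset the exponential decay of `r ^ n`.
  have h1 : ∀ y, ‖χ y‖ ^ 2 ≤ y.coeff.support.card * ‖Φ y‖ ^ 2 := fun y => by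
    have : ‖χ y‖ ≤ ∑ g ∈ y.coeff.support, ‖y.coeff g‖ := by
      rw [lift_unique χ y]
      refine (norm_sum_le _ _).trans (Finset.sum_le_sum fun g _ => ?_)
      rw [norm_smul]
      exact mul_le_of_le_one_right (norm_nonneg _) (hχ g)
    calc ‖χ y‖ ^ 2 ≤ (∑ g ∈ y.coeff.support, ‖y.coeff g‖) ^ 2 := by gcongr
      _ ≤ y.coeff.support.card * ∑ g ∈ y.coeff.support, ‖y.coeff g‖ ^ 2 :=
          sq_sum_le_card_mul_sum_sq
      _ ≤ _ := by gcongr; exact hΦ y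
  by_contra! hlt
  have hpos : 0 < ‖χ x‖ := (norm_nonneg _).trans_lt hlt
  set r := (‖Φ x‖ / ‖χ x‖) ^ 2 with hr
  have hr1 : r < 1 := by
    rw [hr, sq_lt_one_iff₀ (by positivity)]
    exact (div_lt_one hpos).2 hlt
  set N := x.coeff.support.card
  have h2 : ∀ n : ℕ, 0 < n → 1 ≤ ((n : ℝ) + 1) ^ N * r ^ n := fun n hn => by
    have hc : ((x ^ n).coeff.support.card : ℝ) ≤ ((n : ℝ) + 1) ^ N := by
      exact_mod_cast card_support_coeff_pow_le x n
    have h3 := h1 (x ^ n)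
    rw [map_pow, map_pow, norm_pow] at h3
    have h4 : (‖χ x‖ ^ n) ^ 2 ≤ ((n : ℝ) + 1) ^ N * (‖Φ x‖ ^ n) ^ 2 :=
      h3.trans (by gcongr; exact norm_pow_le' _ hn)
    have h5 : r ^ n = (‖Φ x‖ ^ n) ^ 2 / (‖χ x‖ ^ n) ^ 2 := by
      rw [hr, div_pow, div_pow, ← pow_mul, ← pow_mul, ← pow_mul, ← pow_mul, mul_comm 2 n]
    rw [h5, ← mul_div_assoc, one_le_div (by positivity)]
    exact h4
  have hlim : Filter.Tendsto (fun n : ℕ => (2 : ℝ) ^ N * ((n : ℝ) ^ N * r ^ n)) Filter.atTop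
      (nhds 0) := by
    have := (tendsto_pow_const_mul_const_pow_of_abs_lt_one N
      (abs_lt.2 ⟨by linarith [sq_nonneg (‖Φ x‖ / ‖χ x‖)], hr1⟩)).const_mul ((2 : ℝ) ^ N)
    simpa using this
  obtain ⟨n, hn, hn1⟩ := ((hlim.eventually_lt_const one_pos).and
    (Filter.eventually_ge_atTop 1)).exists
  have h6 : ((n : ℝ) + 1) ^ N ≤ 2 ^ N * (n : ℝ) ^ N := by
    rw [← mul_pow]
    have : (1 : ℝ) ≤ n := by exact_mod_cast hn1
    gcongr
    linarith
  have h7 := h2 n hn1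
  have h8 : ((n : ℝ) + 1) ^ N * r ^ n ≤ 2 ^ N * ((n : ℝ) ^ N * r ^ n) := by
    rw [← mul_assoc]; gcongr
  linarith

end MonoidAlgebra

/-- Extension of a dominated unital functional on the range of a homomorphism to a state. -/
theorem exists_isState_extension {A R : Type*} [CStarAlgebra A] [Ring R] [Algebra ℂ R]
    (Φ : R →ₐ[ℂ] A) (χ : R →ₐ[ℂ] ℂ) (h : ∀ x, ‖χ x‖ ≤ ‖Φ x‖) :
    ∃ ω : A →ₗ[ℂ] ℂ, IsState ω ∧ ∀ x, ω (Φ x) = χ x := by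
  -- Domination makes `χ` well defined on the range of `Φ`, where it is contractive; Hahn–Banach
  -- preserves the norm.
  have hker : LinearMap.ker Φ.toLinearMap ≤ LinearMap.ker χ.toLinearMap := fun x hx => by
    have h0 : Φ x = 0 := hx
    have := h x
    rw [h0, norm_zero, norm_le_zero_iff] at this
    exact this
  let f : LinearMap.range Φ.toLinearMap →ₗ[ℂ] ℂ :=
    (Submodule.liftQ _ χ.toLinearMap hker).comp Φ.toLinearMap.quotKerEquivRange.symm.toLinearMap
  have hf : ∀ x, f ⟨Φ x, x, rfl⟩ = χ x := fun x => by
    have : Φ.toLinearMap.quotKerEquivRange.symm ⟨Φ x, x, rfl⟩ = Submodule.Quotient.mk x := by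
      rw [LinearEquiv.symm_apply_eq]; rfl
    simp only [f, LinearMap.comp_apply, LinearEquiv.coe_coe, this]
    rfl
  have hbound : ∀ y, ‖f y‖ ≤ 1 * ‖y‖ := by
    rintro ⟨_, x, rfl⟩
    rw [one_mul]
    exact (congrArg norm (hf x)).le.trans (h x)
  obtain ⟨g, hg, hgn⟩ := exists_extension_norm_eq _ (f.mkContinuous 1 hbound)
  have hval : ∀ x, g (Φ x) = χ x := fun x => (hg ⟨Φ x, x, rfl⟩).trans (hf x)
  refine ⟨g, isState_of_norm_le ?_ fun a => ?_, hval⟩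
  · have := hval 1
    rwa [map_one Φ, map_one χ] at this
  · refine (g.le_opNorm a).trans (mul_le_of_le_one_left (norm_nonneg a) ?_)
    rw [hgn]
    exact f.mkContinuous_norm_le zero_le_one hbound

/-- A closed subspace that contains a multiplicative self-adjoint system of generators contains
the generated C*-algebra. -/
theorem mem_of_mem_topologicalClosure_adjoin {B : Type*} [CStarAlgebra B] {s : Set B}
    (h1 : (1 : B) ∈ Submodule.span ℂ s)
    (hmul : ∀ a ∈ s, ∀ b ∈ s, a * b ∈ Submodule.span ℂ s) (hstar : ∀ a ∈ s, star a ∈ s)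
    {K : Submodule ℂ B} (hK : IsClosed (K : Set B)) (hs : s ⊆ K) {x : B}
    (hx : x ∈ (StarAlgebra.adjoin ℂ s).topologicalClosure) : x ∈ K := by
  -- The linear span of `s` is already a unital *-subalgebra.
  have hspan : ∀ y ∈ StarAlgebra.adjoin ℂ s, y ∈ Submodule.span ℂ s := fun y hy => by
    rw [← StarSubalgebra.mem_toSubalgebra, StarAlgebra.adjoin_toSubalgebra,
      Set.union_eq_self_of_subset_right fun a ha => by simpa using hstar _ ha] at hy
    induction hy using Algebra.adjoin_induction with
    | mem a ha => exact Submodule.subset_span ha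
    | algebraMap c =>
      rw [Algebra.algebraMap_eq_smul_one]
      exact Submodule.smul_mem _ c h1
    | add a b _ _ ha hb => exact add_mem ha hb
    | mul a b _ _ ha hb =>
      have : Submodule.span ℂ s * Submodule.span ℂ s ≤ Submodule.span ℂ s := by
        rw [Submodule.span_mul_span, Submodule.span_le]
        rintro _ ⟨c, hc, d, hd, rfl⟩
        exact hmul c hc d hd
      exact this (Submodule.mul_mem_mul ha hb)
  have hle : (StarAlgebra.adjoin ℂ s : Set B) ⊆ K := fun y hy =>
    Submodule.span_le.2 hs (hspan y hy)
  exact closure_minimal hle hK hx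

/-! ### Elementary tensors. -/

section TensorOp

variable {H K : Type*} [NormedAddCommGroup H] [InnerProductSpace ℂ H] [CompleteSpace H]
  [NormedAddCommGroup K] [InnerProductSpace ℂ K] [CompleteSpace K]

theorem norm_tensorOp_le (a : H →L[ℂ] H) (b : K →L[ℂ] K) : ‖tensorOp a b‖ ≤ ‖a‖ * ‖b‖ := by
  refine ContinuousLinearMap.opNorm_le_bound _ (by positivity) fun z => ?_
  refine HilbertTensor.denseRange_incl.induction_on
    (p := fun z => ‖tensorOp a b z‖ ≤ ‖a‖ * ‖b‖ * ‖z‖) z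
    (isClosed_le (by fun_prop) (by fun_prop)) fun x => ?_
  rw [tensorOp_incl, LinearIsometry.norm_map, LinearIsometry.norm_map]
  refine (ContinuousLinearMap.le_opNorm _ _).trans ?_
  gcongr
  exact TensorProduct.norm_mapL_le a b

/-- The map `a ↦ a ⊗ b`, as a continuous linear map. -/
noncomputable def tensorOpLeft (b : K →L[ℂ] K) :
    (H →L[ℂ] H) →L[ℂ] (HilbertTensor H K →L[ℂ] HilbertTensor H K) :=
  LinearMap.mkContinuous
    { toFun := fun a => tensorOp a b
      map_add' := fun a a' => tensorOp_add_left a a' b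
      map_smul' := fun c a => tensorOp_smul_left c a b } ‖b‖
    fun a => (norm_tensorOp_le a b).trans_eq (mul_comm _ _)

/-- The map `b ↦ a ⊗ b`, as a continuous linear map. -/
noncomputable def tensorOpRight (a : H →L[ℂ] H) :
    (K →L[ℂ] K) →L[ℂ] (HilbertTensor H K →L[ℂ] HilbertTensor H K) :=
  LinearMap.mkContinuous
    { toFun := fun b => tensorOp a b
      map_add' := fun b b' => tensorOp_add_right a b b'
      map_smul' := fun c b => tensorOp_smul_right c a b } ‖a‖
    fun b => norm_tensorOp_le a b

variable {S : StarSubalgebra ℂ (H →L[ℂ] H)} {T : StarSubalgebra ℂ (K →L[ℂ] K)}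

theorem elemTensor_mul (a a' : S) (b b' : T) :
    elemTensor a b * elemTensor a' b' = elemTensor (a * a') (b * b') :=
  Subtype.ext (tensorOp_mul (a : H →L[ℂ] H) a' (b : K →L[ℂ] K) b').symm

theorem elemTensor_star (a : S) (b : T) : star (elemTensor a b) = elemTensor (star a) (star b) :=
  Subtype.ext (tensorOp_star (a : H →L[ℂ] H) (b : K →L[ℂ] K)).symm

theorem elemTensor_one : elemTensor (1 : S) (1 : T) = 1 := Subtype.ext tensorOp_one

theorem elemTensor_smul_smul (c d : ℂ) (a : S) (b : T) :
    elemTensor (c • a) (d • b) = (c * d) • elemTensor a b :=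
  Subtype.ext <| (tensorOp_smul_left c _ _).trans <| by
    rw [mul_smul]
    exact congrArg (c • ·) (tensorOp_smul_right d (a : H →L[ℂ] H) (b : K →L[ℂ] K))

theorem commute_of_mem_factors {x y : spatialTensor S T} (hx : x ∈ leftFactor S T)
    (hy : y ∈ rightFactor S T) : Commute x y := by
  obtain ⟨a, rfl⟩ := hx
  obtain ⟨b, rfl⟩ := hy
  change elemTensor a 1 * elemTensor 1 b = elemTensor 1 b * elemTensor a 1
  rw [elemTensor_mul, elemTensor_mul, one_mul, one_mul, mul_one, mul_one]

end TensorOp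

/-! ### Weyl operators of two particles. -/

section Weyl

theorem weylForm_self (p : ℝ × ℝ) : weylForm p p = 0 := by simp only [weylForm]; ring

theorem star_weylOp (p : ℝ × ℝ) : star (weylOp p) = weylOp (-p) := by
  calc star (weylOp p) = star (weylOp p) * (weylOp p * weylOp (-p)) := by
        rw [weylOp_mul_neg, mul_one]
    _ = weylOp (-p) := by
        rw [← mul_assoc, Unitary.star_mul_self_of_mem (weylOp_mem_unitary p), one_mul]

theorem weylOp_single (p : ℝ × ℝ) :
    weylOp p (lp.single 2 (0 : ℝ × ℝ) (1 : ℂ)) = lp.single 2 p (1 : ℂ) := by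
  ext x
  rw [weylOp_apply]
  by_cases h : x = p
  · subst h
    simp [weylForm_self]
  · rw [lp.single_apply_ne _ _ _ h, lp.single_apply_ne _ _ _ (sub_ne_zero.2 h), mul_zero]

/-- The unitary `W(p) ⊗ W(q)`. -/
noncomputable def twoWeyl (p q : ℝ × ℝ) : TwoParticleAlgebra :=
  elemTensor (weyl p.1 p.2) (weyl q.1 q.2)

theorem weyl_mul (p q : ℝ × ℝ) : weyl p.1 p.2 * weyl q.1 q.2 =
    Complex.exp (Complex.I * weylForm p q) • weyl (p + q).1 (p + q).2 :=
  Subtype.ext (weylOp_mul p q)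

theorem twoWeyl_mul (p q p' q' : ℝ × ℝ) : twoWeyl p q * twoWeyl p' q' =
    Complex.exp (Complex.I * (weylForm p p' + weylForm q q' : ℝ)) •
      twoWeyl (p + p') (q + q') := by
  rw [twoWeyl, twoWeyl, elemTensor_mul, weyl_mul, weyl_mul, elemTensor_smul_smul,
    ← Complex.exp_add, ← mul_add, ← Complex.ofReal_add]
  rfl

theorem weyl_zero : weyl 0 0 = 1 := Subtype.ext weylOp_zero

theorem twoWeyl_zero : twoWeyl 0 0 = 1 := by
  rw [twoWeyl, Prod.fst_zero, Prod.snd_zero, weyl_zero, elemTensor_one]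

theorem star_weyl (p : ℝ × ℝ) : star (weyl p.1 p.2) = weyl (-p).1 (-p).2 :=
  Subtype.ext (star_weylOp p)

theorem star_twoWeyl (p q : ℝ × ℝ) : star (twoWeyl p q) = twoWeyl (-p) (-q) := by
  rw [twoWeyl, elemTensor_star, star_weyl, star_weyl]
  rfl

theorem weylForm_neg_self (p : ℝ × ℝ) : weylForm p (-p) = 0 := by
  simp only [weylForm, Prod.fst_neg, Prod.snd_neg]; ring

theorem weylForm_neg_self' (p : ℝ × ℝ) : weylForm (-p) p = 0 := by
  simp only [weylForm, Prod.fst_neg, Prod.snd_neg]; ring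

theorem twoWeyl_mem_unitary (p q : ℝ × ℝ) : twoWeyl p q ∈ unitary TwoParticleAlgebra := by
  refine Unitary.mem_iff.2 ⟨?_, ?_⟩ <;> rw [star_twoWeyl, twoWeyl_mul]
  · simp [weylForm_neg_self', twoWeyl_zero]
  · simp [weylForm_neg_self, twoWeyl_zero]

theorem twoWeyl_pow (p q : ℝ × ℝ) (n : ℕ) : twoWeyl p q ^ n = twoWeyl (n • p) (n • q) := by
  induction n with
  | zero => simp [twoWeyl_zero]
  | succ n ih =>
    have h : ∀ p : ℝ × ℝ, weylForm (n • p) p = 0 := fun p => by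
      rw [weylForm, Prod.smul_fst, Prod.smul_snd, nsmul_eq_mul, nsmul_eq_mul]; ring
    rw [pow_succ, ih, twoWeyl_mul, h, h, add_zero, Complex.ofReal_zero, mul_zero,
      Complex.exp_zero, one_smul, succ_nsmul, succ_nsmul]

/-- The bounded operators on the two particle Hilbert space. -/
abbrev TwoParticleOperator : Type :=
  HilbertTensor WeylSpace WeylSpace →L[ℂ] HilbertTensor WeylSpace WeylSpace

theorem twoWeyl_anticommute {p q p' q' : ℝ × ℝ} (h : weylForm p p' + weylForm q q' =
    Real.pi + (weylForm p' p + weylForm q' q)) :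
    twoWeyl p q * twoWeyl p' q' = -(twoWeyl p' q' * twoWeyl p q) := by
  rw [twoWeyl_mul, twoWeyl_mul, add_comm p' p, add_comm q' q, ← neg_smul, h, Complex.ofReal_add,
    mul_add, Complex.exp_add, mul_comm Complex.I Real.pi, Complex.exp_pi_mul_I, neg_one_mul]

/-- Linear functionals on the two particle algebra that are continuous and agree on Weyl
operators are equal. -/
theorem linearMap_ext_twoWeyl {ω ω' : TwoParticleAlgebra →ₗ[ℂ] ℂ} (h : Continuous ω)
    (h' : Continuous ω') (heq : ∀ p q, ω (twoWeyl p q) = ω' (twoWeyl p q)) : ω = ω' := by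
  -- The equalizer is moved into the ambient operator algebra, where it stays closed because the
  -- spatial tensor product is closed.
  let D : Submodule ℂ TwoParticleOperator :=
    (LinearMap.eqLocus ω ω').map (spatialTensor weylAlgebra weylAlgebra).subtype.toLinearMap
  have hD : IsClosed (D : Set TwoParticleOperator) := by
    have hc : IsClosed ((spatialTensor weylAlgebra weylAlgebra :
        Set TwoParticleOperator)) :=
      StarSubalgebra.isClosed_topologicalClosure _
    exact hc.isClosedEmbedding_subtypeVal.isClosedMap _ (isClosed_eq h h')
  have gen1 : (1 : WeylSpace →L[ℂ] WeylSpace) ∈ Submodule.span ℂ (Set.range weylOp) :=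
    Submodule.subset_span ⟨0, weylOp_zero⟩
  have gen2 : ∀ a ∈ Set.range weylOp, ∀ b ∈ Set.range weylOp,
      a * b ∈ Submodule.span ℂ (Set.range weylOp) := by
    rintro _ ⟨p, rfl⟩ _ ⟨q, rfl⟩
    rw [weylOp_mul]
    exact Submodule.smul_mem _ _ (Submodule.subset_span ⟨_, rfl⟩)
  have gen3 : ∀ a ∈ Set.range weylOp, star a ∈ Set.range weylOp := by
    rintro _ ⟨p, rfl⟩
    exact ⟨-p, (star_weylOp p).symm⟩
  -- The factors are extended from Weyl operators to the Weyl algebra one at a time, by continuity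
  -- of `a ⊗ b` in each variable.
  have step1 : ∀ q, ∀ a ∈ weylAlgebra, tensorOp a (weylOp q) ∈ D := fun q a ha => by
    refine mem_of_mem_topologicalClosure_adjoin gen1 gen2 gen3
      (K := D.comap (tensorOpLeft (weylOp q)).toLinearMap)
      (hD.preimage (tensorOpLeft (weylOp q)).continuous) ?_ ha
    rintro _ ⟨p, rfl⟩
    exact ⟨twoWeyl p q, heq p q, rfl⟩
  have step2 : ∀ a ∈ weylAlgebra, ∀ b ∈ weylAlgebra, tensorOp a b ∈ D := fun a ha b hb => by
    refine mem_of_mem_topologicalClosure_adjoin gen1 gen2 gen3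
      (K := D.comap (tensorOpRight a).toLinearMap)
      (hD.preimage (tensorOpRight a).continuous) ?_ hb
    rintro _ ⟨q, rfl⟩
    exact step1 q a ha
  ext ⟨x, hx⟩
  have hxD : x ∈ D := by
    refine mem_of_mem_topologicalClosure_adjoin ?_ ?_ ?_ hD ?_ hx
    · exact Submodule.subset_span ⟨1, one_mem _, 1, one_mem _, tensorOp_one.symm⟩
    · rintro _ ⟨a, ha, b, hb, rfl⟩ _ ⟨a', ha', b', hb', rfl⟩
      exact Submodule.subset_span
        ⟨a * a', mul_mem ha ha', b * b', mul_mem hb hb', (tensorOp_mul _ _ _ _).symm⟩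
    · rintro _ ⟨a, ha, b, hb, rfl⟩
      exact ⟨star a, star_mem ha, star b, star_mem hb, (tensorOp_star _ _).symm⟩
    · rintro _ ⟨a, ha, b, hb, rfl⟩
      exact step2 a ha b hb
  obtain ⟨y, hy, rfl⟩ := hxD
  exact hy

/-! ### The EPR character and the existence of the state. -/

/-- The reflection `(a, b) ↦ (-a, b)`. -/
def reflect (p : ℝ × ℝ) : ℝ × ℝ := (-p.1, p.2)

theorem reflect_zero : reflect 0 = 0 := by simp [reflect]

/-- The reflection is antisymplectic, which makes `eprRep` an honest representation and not merely a
projective one. -/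
theorem weylForm_reflect (p q : ℝ × ℝ) : weylForm p q + weylForm (reflect p) (reflect q) = 0 := by
  simp only [weylForm, reflect]; ring

/-- The unitary representation of `ℝ²` by the operators `W(a, b) ⊗ W(-a, b)`. -/
noncomputable def eprRep : Multiplicative (ℝ × ℝ) →* TwoParticleAlgebra where
  toFun g := twoWeyl g.toAdd (reflect g.toAdd)
  map_one' := by
    change twoWeyl 0 (reflect 0) = 1
    rw [reflect_zero, twoWeyl_zero]
  map_mul' g h := by
    rw [twoWeyl_mul, weylForm_reflect, Complex.ofReal_zero, mul_zero, Complex.exp_zero, one_smul]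
    congr 1
    ext <;> simp [reflect, add_comm]

/-- The character `(a, b) ↦ exp(i (a l + b m))` of `ℝ²`. -/
noncomputable def eprChar (l m : ℝ) : Multiplicative (ℝ × ℝ) →* ℂ where
  toFun g := Complex.exp (Complex.I * (g.toAdd.1 * l + g.toAdd.2 * m : ℝ))
  map_one' := by simp
  map_mul' g h := by
    rw [← Complex.exp_add, ← mul_add, ← Complex.ofReal_add]
    congr 3
    simp only [toAdd_mul, Prod.fst_add, Prod.snd_add]
    ring

/-- The vectors `δ_p ⊗ δ_q`, `q` the reflection of `p`. -/
noncomputable def eprVec (p : ℝ × ℝ) : HilbertTensor WeylSpace WeylSpace :=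
  HilbertTensor.incl
    ((lp.single 2 p (1 : ℂ) : WeylSpace) ⊗ₜ[ℂ] (lp.single 2 (reflect p) (1 : ℂ) : WeylSpace))

theorem orthonormal_eprVec : Orthonormal ℂ eprVec := by
  rw [orthonormal_iff_ite]
  intro p q
  rw [eprVec, eprVec, LinearIsometry.inner_map_map, TensorProduct.inner_tmul,
    lp.inner_single_left, lp.inner_single_left]
  by_cases h : p = q
  · subst h; simp
  · rw [lp.single_apply_ne _ _ _ h]
    simp [h]

theorem eprRep_apply_eprVec (g : Multiplicative (ℝ × ℝ)) :
    (eprRep g : TwoParticleOperator) (eprVec 0) = eprVec g.toAdd := by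
  change tensorOp (weylOp g.toAdd) (weylOp (reflect g.toAdd)) (eprVec 0) = _
  rw [eprVec, reflect_zero, tensorOp_incl, TensorProduct.mapL_tmul, weylOp_single, weylOp_single]
  rfl

/-- The operator is tested on the unit vector `δ₀ ⊗ δ₀`, whose orbit is orthonormal. -/
theorem sum_norm_sq_le_norm_lift_eprRep_sq (x : MonoidAlgebra ℂ (Multiplicative (ℝ × ℝ))) :
    ∑ g ∈ x.coeff.support, ‖x.coeff g‖ ^ 2 ≤ ‖MonoidAlgebra.lift ℂ _ _ eprRep x‖ ^ 2 := by
  set T : TwoParticleOperator :=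
    Subtype.val (MonoidAlgebra.lift ℂ _ _ eprRep x : TwoParticleAlgebra) with hT
  have e : T (eprVec 0) = ∑ g ∈ x.coeff.support, x.coeff g • eprVec g.toAdd := by
    rw [hT, MonoidAlgebra.lift_apply, Finsupp.sum]
    simp only [AddSubmonoidClass.coe_finsetSum, sum_apply]
    exact Finset.sum_congr rfl fun g _ => congrArg (x.coeff g • ·) (eprRep_apply_eprVec g)
  have ho : Orthonormal ℂ fun g : Multiplicative (ℝ × ℝ) => eprVec g.toAdd :=
    orthonormal_eprVec.comp _ Multiplicative.toAdd.injective
  have h1 : ‖T (eprVec 0)‖ ≤ ‖T‖ := by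
    have := T.le_opNorm (eprVec 0)
    rwa [orthonormal_eprVec.1, mul_one] at this
  have h2 : ∑ g ∈ x.coeff.support, ‖x.coeff g‖ ^ 2 = ‖T (eprVec 0)‖ ^ 2 := by
    have := ho.inner_sum (fun g => x.coeff g) (fun g => x.coeff g) x.coeff.support
    rw [← e, inner_self_eq_norm_sq_to_K] at this
    simp only [Complex.conj_mul'] at this
    exact Complex.ofReal_injective (by push_cast; exact this.symm)
  rw [h2]
  exact pow_le_pow_left₀ (norm_nonneg _) h1 2

theorem norm_eprChar (l m : ℝ) (g : Multiplicative (ℝ × ℝ)) : ‖eprChar l m g‖ = 1 :=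
  norm_weylPhase _

theorem exists_isEPRState (l m : ℝ) : ∃ ω, IsEPRState l m ω := by
  obtain ⟨ω, hω, hval⟩ := exists_isState_extension (MonoidAlgebra.lift ℂ _ _ eprRep)
    (MonoidAlgebra.lift ℂ _ _ (eprChar l m))
    (MonoidAlgebra.norm_character_le _ _ (fun g => by simp [norm_eprChar])
      sum_norm_sq_le_norm_lift_eprRep_sq)
  have h : ∀ g, ω (eprRep g) = eprChar l m g := fun g => by
    simpa using hval (MonoidAlgebra.single g 1)
  refine ⟨ω, hω, fun a => ?_, fun b => ?_⟩
  · refine (h (Multiplicative.ofAdd (a, 0))).trans ?_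
    simp [eprChar]
  · have e : eprRep (Multiplicative.ofAdd (0, b)) = elemTensor (weyl 0 b) (weyl 0 b) := by
      simp [eprRep, twoWeyl, reflect]
    rw [← e, h]
    simp [eprChar]

/-! ### Uniqueness and maximal Bell correlation of the EPR state. -/

namespace IsEPRState

variable {l m : ℝ} {ω : TwoParticleAlgebra →ₗ[ℂ] ℂ}

/-- The prescribed values on the two axes have modulus one, so the state is multiplicative there and
the axes determine the rest. -/
theorem eprRep_eq (hω : IsEPRState l m ω) (g : Multiplicative (ℝ × ℝ)) :
    ω (eprRep g) = eprChar l m g := by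
  have h1 : ω (eprRep (Multiplicative.ofAdd (g.toAdd.1, 0))) =
      eprChar l m (Multiplicative.ofAdd (g.toAdd.1, 0)) := by
    refine (hω.position g.toAdd.1).trans ?_
    simp [eprChar]
  have h2 : ω (eprRep (Multiplicative.ofAdd (0, g.toAdd.2))) =
      eprChar l m (Multiplicative.ofAdd (0, g.toAdd.2)) := by
    have e : eprRep (Multiplicative.ofAdd (0, g.toAdd.2)) =
        elemTensor (weyl 0 g.toAdd.2) (weyl 0 g.toAdd.2) := by
      simp [eprRep, twoWeyl, reflect]
    rw [e, hω.momentum]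
    simp [eprChar]
  have e : g = Multiplicative.ofAdd (g.toAdd.1, 0) * Multiplicative.ofAdd (0, g.toAdd.2) := by
    rw [← ofAdd_add]
    simp
  have hu : eprRep (Multiplicative.ofAdd (g.toAdd.1, 0)) ∈ unitary TwoParticleAlgebra :=
    twoWeyl_mem_unitary _ _
  rw [e, map_mul, (hω.isState.map_mul_of_unitary hu (norm_eprChar l m _) h1 _).1, h2, map_mul]

theorem twoWeyl_eq_zero (hω : IsEPRState l m ω) {p q : ℝ × ℝ} (h : q ≠ reflect p) :
    ω (twoWeyl p q) = 0 := by
  -- The left side is the commutator phase of `eprRep g` with `W(p) ⊗ W(q)`. As a linear form in `g`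
  -- it vanishes only if `q = reflect p`, so otherwise it takes the value `π`, that is,
  -- anticommutation.
  obtain ⟨g, hg⟩ : ∃ g : ℝ × ℝ, g.1 * (p.2 - q.2) - g.2 * (p.1 + q.1) = Real.pi := by
    by_cases h2 : p.2 - q.2 = 0
    · have h1 : p.1 + q.1 ≠ 0 := fun h1 => h (Prod.ext
        (by simp only [reflect]; linarith) (by simp only [reflect]; linarith))
      exact ⟨(0, -Real.pi / (p.1 + q.1)), by field_simp; ring⟩
    · exact ⟨(Real.pi / (p.2 - q.2), 0), by simp [div_mul_cancel₀ _ h2]⟩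
  have key := hω.isState.map_mul_of_unitary (twoWeyl_mem_unitary g (reflect g))
    (norm_eprChar l m _) (hω.eprRep_eq (Multiplicative.ofAdd g)) (twoWeyl p q)
  have hcomm : twoWeyl g (reflect g) * twoWeyl p q =
      -(twoWeyl p q * twoWeyl g (reflect g)) := twoWeyl_anticommute <| by
    rw [← hg]; simp only [weylForm, reflect]; ring
  rw [hcomm, map_neg, key.2] at key
  have hne : eprChar l m (Multiplicative.ofAdd g) ≠ 0 := Complex.exp_ne_zero _
  have := self_eq_neg.1 key.1.symm
  exact (mul_eq_zero.1 this).resolve_left hne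

theorem unique {ω' : TwoParticleAlgebra →ₗ[ℂ] ℂ} (hω : IsEPRState l m ω)
    (hω' : IsEPRState l m ω') : ω = ω' := by
  refine linearMap_ext_twoWeyl hω.isState.continuous hω'.isState.continuous fun p q => ?_
  by_cases h : q = reflect p
  · subst h
    exact (hω.eprRep_eq (Multiplicative.ofAdd p)).trans
      (hω'.eprRep_eq (Multiplicative.ofAdd p)).symm
  · rw [hω.twoWeyl_eq_zero h, hω'.twoWeyl_eq_zero h]

/-- Up to a phase the product is `W((i - j)p) ⊗ W(0)`, and `0` is not the reflection of a nonzero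
vector. -/
theorem map_pow_mul_star_pow (hω : IsEPRState l m ω) {p : ℝ × ℝ} (hp : p ≠ 0) {i j : ℕ}
    (hij : i ≠ j) : ω (twoWeyl p 0 ^ i * star (twoWeyl p 0) ^ j) = 0 := by
  rw [star_twoWeyl, twoWeyl_pow, twoWeyl_pow, twoWeyl_mul, map_smul, hω.twoWeyl_eq_zero, smul_zero]
  intro h
  have h1 : (i : ℝ) - j ≠ 0 := sub_ne_zero.2 (by exact_mod_cast hij)
  have e1 := congrArg Prod.fst h
  have e2 := congrArg Prod.snd h
  simp [reflect] at e1 e2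
  refine hp (Prod.ext ?_ ?_)
  · exact (mul_eq_zero.1 (by linear_combination e1 : ((i : ℝ) - j) * p.1 = 0)).resolve_left h1
  · exact (mul_eq_zero.1 (by linear_combination -e2 : ((i : ℝ) - j) * p.2 = 0)).resolve_left h1

theorem isMaximallyBellCorrelated (hω : IsEPRState l m ω) :
    IsMaximallyBellCorrelated ω (leftFactor weylAlgebra weylAlgebra)
      (rightFactor weylAlgebra weylAlgebra) := by
  have hleft : ∀ p, twoWeyl p 0 ∈ leftFactor weylAlgebra weylAlgebra := fun p =>
    ⟨weyl p.1 p.2, congrArg (elemTensor (weyl p.1 p.2)) weyl_zero.symm⟩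
  have hright : ∀ q, twoWeyl 0 q ∈ rightFactor weylAlgebra weylAlgebra := fun q =>
    ⟨weyl q.1 q.2, congrArg (elemTensor · (weyl q.1 q.2)) weyl_zero.symm⟩
  have hunit : ∀ (g : Multiplicative (ℝ × ℝ)) (u : TwoParticleAlgebra), u ∈ unitary _ →
      star (eprChar l m g) • u ∈ unitary TwoParticleAlgebra := fun g u hu => by
    have hc : star (eprChar l m g) * eprChar l m g = 1 := by
      rw [Complex.star_def, Complex.conj_mul', norm_eprChar]; simp
    refine Unitary.mem_iff.2 ⟨?_, ?_⟩
    · rw [star_smul, star_star, smul_mul_smul_comm, Unitary.star_mul_self_of_mem hu, mul_comm,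
        hc, one_smul]
    · rw [star_smul, star_star, smul_mul_smul_comm, Unitary.mul_star_self_of_mem hu, hc, one_smul]
  -- The partner is multiplied by the conjugate of the character value, to normalize the correlation
  -- to 1.
  have hval : ∀ g : Multiplicative (ℝ × ℝ),
      ω (twoWeyl g.toAdd 0 * star (eprChar l m g) • twoWeyl 0 (reflect g.toAdd)) = 1 := fun g => by
    have e : twoWeyl g.toAdd 0 * twoWeyl 0 (reflect g.toAdd) = eprRep g := by
      rw [twoWeyl_mul]
      simp [weylForm, eprRep]
    rw [mul_smul_comm, map_smul, e, hω.eprRep_eq, smul_eq_mul, Complex.star_def,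
      Complex.conj_mul', norm_eprChar]
    simp
  let g₁ : Multiplicative (ℝ × ℝ) := Multiplicative.ofAdd (1, 0)
  -- The form of `(1, 0)` and `(0, π)` is `π/2`, so the commutation phase is `exp(iπ) = -1`.
  let g₂ : Multiplicative (ℝ × ℝ) := Multiplicative.ofAdd (0, Real.pi)
  refine hω.isState.isMaximallyBellCorrelated_of_anticommute
    (fun a ha b hb => commute_of_mem_factors ha hb)
    (twoWeyl_mem_unitary g₁.toAdd 0) (twoWeyl_mem_unitary g₂.toAdd 0)
    (hunit g₁ _ (twoWeyl_mem_unitary 0 (reflect g₁.toAdd)))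
    (hunit g₂ _ (twoWeyl_mem_unitary 0 (reflect g₂.toAdd)))
    (hleft _) (hleft _) (StarSubalgebra.smul_mem _ (hright _) _)
    (StarSubalgebra.smul_mem _ (hright _) _) ?_ (hval g₁) (hval g₂)
    (fun i j h => hω.map_pow_mul_star_pow (by simp [g₁]) h)
    (fun i j h => hω.map_pow_mul_star_pow (by simp [g₂, Real.pi_ne_zero]) h)
  rw [smul_mul_smul_comm, smul_mul_smul_comm, mul_comm (star (eprChar l m g₂)), ← smul_neg]
  congr 1
  -- The reflection reverses the sign of the form, so the phase is `+π` with the two operators in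
  -- the opposite order.
  refine neg_eq_iff_eq_neg.1 (twoWeyl_anticommute ?_).symm
  simp [weylForm, reflect, g₁, g₂]
  ring

end IsEPRState

end Weyl

theorem theorem2 (l m : ℝ) :
    (∃! ω : TwoParticleAlgebra →ₗ[ℂ] ℂ, IsEPRState l m ω) ∧
      ∀ ω : TwoParticleAlgebra →ₗ[ℂ] ℂ, IsEPRState l m ω →
        IsMaximallyBellCorrelated ω (leftFactor weylAlgebra weylAlgebra)
          (rightFactor weylAlgebra weylAlgebra) := by
  obtain ⟨ω, hω⟩ := exists_isEPRState l m
  exact ⟨⟨ω, hω, fun _ h => h.unique hω⟩, fun _ h => h.isMaximallyBellCorrelated⟩
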